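/- Let $m_1\ge 3$ and $m_2\ge 0$ be integers and put $N=3^{m_1}+2m_2-1$. Let $a_{2s+1}=3^{s}-1$ and $a_{2s+2}=2\cdot 3^{s}-1$ for $s\ge 0$, and let $\mathcal K=\mathcal K_{2m_1,N}$ be the system of $2m_1$-gons $$F_j=(j+a_1,\;j+a_2,\;\dots,\;j+a_{2m_1-1},\;j+a_{2m_1}+m_2),\qquad j\in\mathbb Z/N\mathbb Z,$$ on the $N$ vertices $\mathbb Z/N\mathbb Z$. Then: (1) $\mathcal K$ is a self-dual equivelar map of type $[(2m_1)^{2m_1}]$ on a connected closed surface. That is, the faces are cycles of length $2m_1$ in a connected simple graph, the faces at each vertex form a single cycle of length $2m_1$, and there is an incidence-reversing bijection exchanging vertices with faces and mapping edges to edges. (2) Let $H_X$ and $H_Z$ be the vertex-edge and the face-edge incidence matrices of $\mathcal K$ over $\mathbb Z_2$. Then $H_XH_Z^{T}=0$. Place one qubit on each edge, and let $\mathcal S$ be the group generated by the operators $A_v=\bigotimes_{e\ni v}X$ for the vertices $v$ and $B_f=\bigotimes_{e\subset\partial f}Z$ for the faces $f$. Then $\mathcal S$ is a stabilizer group (a group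 of Pauli operators with $-I\notin\mathcal S$), and its code, the common $(+1)$-eigenspace of $\mathcal S$ (the homological quantum code of $\mathcal K$), is an $$[[\,m_1(3^{m_1}+2m_2-1),\;2+(m_1-2)(3^{m_1}+2m_2-1),\;4\,]]$$ quantum code. Here $[[n,k,d]]$ means that there are $n$ qubits, that the code space has dimension $2^k$, and that $d$ is the smallest weight of a Pauli operator that commutes with all of $\mathcal S$ but is not a scalar multiple of an element of $\mathcal S$. (3) The encoding rate $k/n$ of these codes tends to $1$ as $m_1\to\infty$, uniformly in $m_2\ge 0$; in particular it tends to $1$ as $m_1,m_2\to\infty$. -/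

import Mathlib

open Filter Topology
open scoped Matrix

/-! ### Maps on surfaces, combinatorially -/

/-- A system of polygons on a vertex set `V`, indexed by `F`: the polygon `f` has `len f` corners,
and `vert f` lists them in cyclic order. -/
structure PolygonSystem (V F : Type) where
  len : F → ℕ
  vert : (f : F) → ZMod (len f) → V

namespace PolygonSystem

variable {V F : Type} (K : PolygonSystem V F)

/-- The set of vertices of the polygon `f`. -/
def verts (f : F) : Set V := Set.range (K.vert f)

/-- The set of edges of the polygon `f`: the pairs of cyclically consecutive corners. -/
def boundary (f : F) : Set (Sym2 V) := Set.range fun i => s(K.vert f i, K.vert f (i + 1))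

/-- All edges. -/
def edgeSet : Set (Sym2 V) := {e | ∃ f, e ∈ K.boundary f}

abbrev Edge : Type := {e : Sym2 V // e ∈ K.edgeSet}

noncomputable instance [Finite V] : Fintype K.Edge := Fintype.ofFinite _

/-- The faces containing `v` form one cycle of length `d`: they are the distinct faces
`C 0, …, C (d - 1)`, and consecutive faces `C i`, `C (i + 1)` share the edge `v u_{i+1}`, where
`u 0, …, u (d - 1)` are distinct vertices (indices modulo `d`). -/
def FaceCycleAt (v : V) (d : ℕ) : Prop :=
  ∃ (u : ZMod d → V) (C : ZMod d → F), Function.Injective u ∧ Function.Injective C ∧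
    (∀ f, v ∈ K.verts f ↔ ∃ i, C i = f) ∧
    ∀ i, s(v, u i) ∈ K.boundary (C i) ∧ s(v, u (i + 1)) ∈ K.boundary (C i)

/-- `K` is (the combinatorial form of) a map on a closed connected surface: every face is bounded
by a cycle of a simple graph, the graph is connected, and the faces around each vertex form a
single cycle, so that gluing discs to the face boundaries gives a connected closed surface. -/
structure IsMap : Prop where
  three_le_len : ∀ f, 3 ≤ K.len f
  vert_injective : ∀ f, Function.Injective (K.vert f)
  connected : (SimpleGraph.fromEdgeSet K.edgeSet).Connected
  faceCycle : ∀ v, ∃ d, 3 ≤ d ∧ K.FaceCycleAt v d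

/-- An equivelar map of type `[p^q]`: all faces are `p`-gons, and `q` of them meet at each
vertex. -/
def IsEquivelar (p q : ℕ) : Prop :=
  K.IsMap ∧ (∀ f, K.len f = p) ∧ ∀ v, K.FaceCycleAt v q

/-- `K` is isomorphic to its dual map: there are bijections from vertices to faces, from edges to
edges, and from faces to vertices that reverse all incidences. -/
def IsSelfDual : Prop :=
  ∃ (φ : V ≃ F) (ε : K.Edge ≃ K.Edge) (ψ : F ≃ V),
    (∀ v e, v ∈ e.1 ↔ (ε e).1 ∈ K.boundary (φ v)) ∧
    (∀ e f, e.1 ∈ K.boundary f ↔ ψ f ∈ (ε e).1) ∧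
    (∀ v f, v ∈ K.verts f ↔ ψ f ∈ K.verts (φ v))

open Classical in
/-- The vertex-edge incidence matrix, i.e. the matrix of `∂₁` over `ℤ/2`. -/
noncomputable def vertexEdgeMatrix : Matrix V K.Edge (ZMod 2) :=
  Matrix.of fun v e => if v ∈ e.1 then 1 else 0

open Classical in
/-- The face-edge incidence matrix, i.e. the transpose of the matrix of `∂₂` over `ℤ/2`. -/
noncomputable def faceEdgeMatrix : Matrix F K.Edge (ZMod 2) :=
  Matrix.of fun f e => if e.1 ∈ K.boundary f then 1 else 0

end PolygonSystem

/-! ### Qubits, Pauli operators and stabilizer codes -/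

inductive Pauli where
  | I | X | Y | Z

namespace Pauli

noncomputable def toMatrix : Pauli → Matrix (Fin 2) (Fin 2) ℂ
  | I => 1
  | X => !![0, 1; 1, 0]
  | Y => !![0, -Complex.I; Complex.I, 0]
  | Z => !![1, 0; 0, -1]

end Pauli

section Qubits

variable {E : Type} [Fintype E] [DecidableEq E]

/-- The operators on the state space `(ℂ²)^{⊗ E}` of qubits labelled by `E`, as matrices in the
computational basis, which is indexed by bit strings. -/
abbrev QubitOp (E : Type) : Type := Matrix (E → Fin 2) (E → Fin 2) ℂ

/-- The tensor product `⨂ₑ P e` of Pauli matrices, as a matrix in the computational basis. -/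
noncomputable def pauliTensor (P : E → Pauli) : QubitOp E :=
  Matrix.of fun x y => ∏ e, (P e).toMatrix (x e) (y e)

/-- The weight of a Pauli tensor: the number of its factors other than the identity. -/
noncomputable def pauliWeight (P : E → Pauli) : ℕ := {e | P e ≠ Pauli.I}.ncard

/-- The Pauli group: all `c ⨂ₑ P e` with `c ∈ {±1, ±i}`. -/
def pauliGroup (E : Type) [Fintype E] [DecidableEq E] : Set (QubitOp E)ˣ :=
  {g | ∃ (c : ℂ) (P : E → Pauli), (c = 1 ∨ c = -1 ∨ c = Complex.I ∨ c = -Complex.I) ∧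
    (g : QubitOp E) = c • pauliTensor P}

/-- A stabilizer group is a subgroup of the Pauli group that does not contain `-1`. -/
def IsStabilizerGroup (S : Subgroup (QubitOp E)ˣ) : Prop :=
  (∀ g ∈ S, g ∈ pauliGroup E) ∧ -1 ∉ S

/-- The code stabilized by `S`: the states fixed by all elements of `S`. -/
def stabilizerCode (S : Subgroup (QubitOp E)ˣ) : Submodule ℂ ((E → Fin 2) → ℂ) where
  carrier := {ψ | ∀ g ∈ S, (g : QubitOp E) *ᵥ ψ = ψ}
  add_mem' {a b} ha hb g hg := by
    rw [Matrix.mulVec_add, ha g hg, hb g hg]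
  zero_mem' g _ := Matrix.mulVec_zero _
  smul_mem' c a ha g hg := by
    rw [Matrix.mulVec_smul, ha g hg]

/-- The weights of the Pauli operators that commute with `S` and do not belong to `S`. Operators
that differ by a scalar phase are identified: a multiple of an element of `S` acts on the code as
a scalar and is not counted as an error. -/
def logicalWeights (S : Subgroup (QubitOp E)ˣ) : Set ℕ :=
  {w | ∃ P : E → Pauli, pauliWeight P = w ∧
    (∀ g ∈ S, Commute (pauliTensor P) (g : QubitOp E)) ∧
    ∀ g ∈ S, ∀ c : ℂ, (g : QubitOp E) ≠ c • pauliTensor P}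

/-- `S` defines an `[[n, k, d]]` stabilizer code: `n` qubits, a code space of dimension `2 ^ k`,
and minimum distance `d`. -/
structure IsQuantumCode (S : Subgroup (QubitOp E)ˣ) (n k d : ℕ) : Prop where
  stabilizer : IsStabilizerGroup S
  length : Fintype.card E = n
  dimension : Module.finrank ℂ (stabilizerCode S) = 2 ^ k
  distance : IsLeast (logicalWeights S) d

/-- The encoding rate `k / n`, where `k` is the base-two logarithm of the dimension of the
code. -/
noncomputable def encodingRate (S : Subgroup (QubitOp E)ˣ) : ℝ :=
  Real.logb 2 (Module.finrank ℂ (stabilizerCode S)) / Fintype.card E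

/-- The stabilizer group with binary check matrix `[H_X 0; 0 H_Z]`: it is generated by the
operators `⨂ₑ X^(H_X a e)` and `⨂ₑ Z^(H_Z b e)`. -/
def checkStabilizer {A B : Type} (HX : Matrix A E (ZMod 2)) (HZ : Matrix B E (ZMod 2)) :
    Subgroup (QubitOp E)ˣ :=
  Subgroup.closure
    ({g | ∃ a, (g : QubitOp E) = pauliTensor fun e => if HX a e = 1 then Pauli.X else Pauli.I} ∪
     {g | ∃ b, (g : QubitOp E) = pauliTensor fun e => if HZ b e = 1 then Pauli.Z else Pauli.I})

end Qubits

/-- The stabilizer group of the homological quantum code of a map. Qubits are the edges; there is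
one generator `A_v` for each vertex and one generator `B_f` for each face. -/
noncomputable def homologicalStabilizer {V F : Type} [Finite V] [DecidableEq V]
    (K : PolygonSystem V F) : Subgroup (QubitOp K.Edge)ˣ :=
  checkStabilizer K.vertexEdgeMatrix K.faceEdgeMatrix

/-! ### The maps `K_{2m₁, 3^m₁ + 2m₂ - 1}` -/

/-- `cornerOffset t = a_{t+1}`, where `a_{2s+1} = 3^s - 1` and `a_{2s+2} = 2·3^s - 1`. -/
def cornerOffset (t : ℕ) : ℕ :=
  if t % 2 = 0 then 3 ^ (t / 2) - 1 else 2 * 3 ^ (t / 2) - 1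

/-- With `N = 3^m₁ + 2m₂ - 1`, the map with vertex set `ℤ/N = {0, …, N - 1}` and faces
`F_j = (j + a₁, j + a₂, …, j + a_{2m₁-1}, j + a_{2m₁} + m₂)` (modulo `N`), for `j ∈ ℤ/N`. -/
def dattaMap (m₁ m₂ : ℕ) :
    PolygonSystem (Fin (3 ^ m₁ + 2 * m₂ - 1)) (Fin (3 ^ m₁ + 2 * m₂ - 1)) where
  len _ := 2 * m₁
  vert j i :=
    ⟨(j.val + cornerOffset i.val + if i.val + 1 = 2 * m₁ then m₂ else 0) %
      (3 ^ m₁ + 2 * m₂ - 1), Nat.mod_lt _ (Fin.pos j)⟩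

/-! Write m = m₁ and let D_s run through the steps 1, 3, …, 3^(m-2), 3^(m-1) + m₂. The polygon takes
each step twice in a row, and 2 ∑ D_s = N, so it closes up after one turn around ℤ/N. Hence the edge
{w, w + D_s} lies on exactly two translates, those with indices w - c(2s) and w - c(2s+1), which
again differ by D_s. The graph and its dual are therefore the same Cayley graph of ℤ/N with steps
±D_s, up to relabelling edges, and v ↦ -v gives a duality. `IsDoubledStepPolygon` isolates the
properties of the polygon that this needs.

For the code, Pauli operators are written as X^a Z^b up to a phase. Because H_X H_Zᵀ = 0, no signs
arise in the stabilizer, and code states are the functions supported on ker H_Z and constant on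
cosets of the row space of H_X. This gives the dimension 2^(n - rank H_X - rank H_Z). Both ranks are
N - 1 by connectedness, so k = mN - 2(N - 1).

Both check matrices are incidence matrices of a simple triangle-free graph, so every nonzero cycle,
homologically trivial or not, has at least four edges. Absence of triangles is an estimate modulo N:
with q = 3^(m-2), all steps but the last are odd and at most q, the last is 3q + m₂, and N = 9q +
2m₂ - 1. A vanishing sum of three signed steps would be 0 or ±N as an integer, which size and parity
exclude. Weight four is attained by the square 0, 1, 4, 3: some closed walk of length four in the
dual graph crosses it exactly once, so it is not a boundary.

Finally 1 - k/n = (2N - 2)/(mN) is below 2/m, whatever m₂ is. -/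

set_option linter.unusedSectionVars false
/-! ### Weyl operators -/

/-- The sign character `z ↦ (-1)^z` of `ℤ/2`. -/
noncomputable def signChar : AddChar (ZMod 2) ℂ where
  toFun z := if z = 0 then 1 else -1
  map_zero_eq_one' := by simp
  map_add_eq_mul' x y := by
    revert x y
    -- `ZMod 2` unfolds to `Fin 2`, where the four cases can be listed.
    rw [show (∀ x y : ZMod 2, (if x + y = 0 then (1 : ℂ) else -1) =
      (if x = 0 then 1 else -1) * (if y = 0 then 1 else -1)) ↔
      ∀ x y : Fin 2, (if x + y = 0 then (1 : ℂ) else -1) =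
      (if x = 0 then 1 else -1) * (if y = 0 then 1 else -1) from Iff.rfl]
    simp [Fin.forall_fin_two]

lemma ZMod.two_eq_zero_or_one (z : ZMod 2) : z = 0 ∨ z = 1 := by
  revert z; decide

lemma signChar_one : signChar 1 = -1 := by
  change (if (1 : ZMod 2) = 0 then (1 : ℂ) else -1) = -1
  exact if_neg one_ne_zero

lemma signChar_eq_one_iff (z : ZMod 2) : signChar z = 1 ↔ z = 0 := by
  rcases ZMod.two_eq_zero_or_one z with rfl | rfl
  · simp
  · rw [signChar_one]; norm_num

lemma signChar_sum {ι : Type*} (s : Finset ι) (f : ι → ZMod 2) :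
    signChar (∑ i ∈ s, f i) = ∏ i ∈ s, signChar (f i) := by
  classical
  induction s using Finset.induction_on with
  | empty => simp
  | insert i s hi h => rw [Finset.sum_insert hi, Finset.prod_insert hi, AddChar.map_add_eq_mul, h]

lemma signChar_injective : Function.Injective signChar := by
  intro x y h
  rcases ZMod.two_eq_zero_or_one x with rfl | rfl <;>
  rcases ZMod.two_eq_zero_or_one y with rfl | rfl
  · rfl
  · rw [AddChar.map_zero_eq_one] at h; exact ((signChar_eq_one_iff _).1 h.symm).symm
  · rw [AddChar.map_zero_eq_one] at h; exact (signChar_eq_one_iff _).1 h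
  · rfl

section Weyl

variable {E : Type}

/-- The entries of an operator, with bit strings as vectors over `ℤ/2`. -/
def QubitOp.entry (M : QubitOp E) (x y : E → ZMod 2) : ℂ := M x y

lemma QubitOp.entry_ext {M M' : QubitOp E} (h : ∀ x y, M.entry x y = M'.entry x y) : M = M' :=
  Matrix.ext h

lemma QubitOp.entry_smul (c : ℂ) (M : QubitOp E) (x y : E → ZMod 2) :
    QubitOp.entry (c • M) x y = c * M.entry x y := rfl

lemma add_self_zmod_two (a : E → ZMod 2) : a + a = 0 := by
  funext e; exact CharTwo.add_self_eq_zero (a e)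

variable [Fintype E]

/-- The operator `X^a Z^b`. -/
noncomputable def weylOp (a b : E → ZMod 2) : QubitOp E :=
  Matrix.of fun (x y : E → ZMod 2) => if x = y + a then signChar (b ⬝ᵥ y) else 0

lemma entry_weylOp (a b x y : E → ZMod 2) :
    (weylOp a b).entry x y = if x = y + a then signChar (b ⬝ᵥ y) else 0 := rfl

lemma entry_weylOp_self_zero (a b : E → ZMod 2) : (weylOp a b).entry a 0 = 1 := by
  rw [entry_weylOp, if_pos (zero_add a).symm, dotProduct_zero, AddChar.map_zero_eq_one]

lemma weylOp_ne_zero (a b : E → ZMod 2) : weylOp a b ≠ 0 := by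
  intro h
  have := entry_weylOp_self_zero a b
  rw [h] at this
  exact zero_ne_one this

variable [DecidableEq E]

/-- The action of an operator on states, with bit strings as vectors over `ℤ/2`. -/
def QubitOp.act (M : QubitOp E) (ψ : (E → ZMod 2) → ℂ) (x : E → ZMod 2) : ℂ := (M *ᵥ ψ) x

lemma QubitOp.entry_mul (M M' : QubitOp E) (x y : E → ZMod 2) :
    QubitOp.entry (M * M') x y = M.act (fun w => M'.entry w y) x := rfl

lemma QubitOp.entry_one (x y : E → ZMod 2) :
    QubitOp.entry (1 : QubitOp E) x y = if x = y then 1 else 0 :=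
  Matrix.one_apply (n := E → Fin 2)

lemma act_weylOp (a b : E → ZMod 2) (ψ : (E → ZMod 2) → ℂ) (x : E → ZMod 2) :
    (weylOp a b).act ψ x = signChar (b ⬝ᵥ (x + a)) * ψ (x + a) := by
  have h : (weylOp a b).act ψ x = ∑ y : E → ZMod 2, (weylOp a b).entry x y * ψ y := rfl
  rw [h, Finset.sum_eq_single (x + a)]
  · rw [entry_weylOp, if_pos]
    rw [add_assoc, add_self_zmod_two, add_zero]
  · intro y _ hy
    rw [entry_weylOp, if_neg, zero_mul]
    rintro rfl
    exact hy (by rw [add_assoc, add_self_zmod_two, add_zero])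
  · simp

lemma weylOp_zero : weylOp (0 : E → ZMod 2) 0 = 1 := by
  refine QubitOp.entry_ext fun x y => ?_
  rw [entry_weylOp, QubitOp.entry_one, add_zero, zero_dotProduct, AddChar.map_zero_eq_one]

/-- Moving `Z^b` past `X^a'` costs the sign `(-1)^(b · a')`. -/
lemma weylOp_mul (a b a' b' : E → ZMod 2) :
    weylOp a b * weylOp a' b' = signChar (b ⬝ᵥ a') • weylOp (a + a') (b + b') := by
  refine QubitOp.entry_ext fun x y => ?_
  rw [QubitOp.entry_mul, act_weylOp, QubitOp.entry_smul, entry_weylOp, entry_weylOp]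
  by_cases hx : x = y + (a + a')
  · have hx' : x + a = y + a' := by
      rw [hx, add_assoc, add_comm (a + a'), ← add_assoc a, add_self_zmod_two, zero_add]
    rw [if_pos hx', if_pos hx, hx', dotProduct_add, add_dotProduct, AddChar.map_add_eq_mul,
      AddChar.map_add_eq_mul]
    ring
  · rw [if_neg hx, if_neg, mul_zero, mul_zero]
    intro hx'
    apply hx
    have := congrArg (· + a) hx'
    simp only [add_assoc, add_self_zmod_two, add_zero] at this
    rw [this, add_comm a]

lemma weylOp_mul_self {a b : E → ZMod 2} (h : b ⬝ᵥ a = 0) : weylOp a b * weylOp a b = 1 := by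
  rw [weylOp_mul, h, AddChar.map_zero_eq_one, one_smul, add_self_zmod_two, add_self_zmod_two,
    weylOp_zero]

/-- Column `0` has its only nonzero entry, a `1`, in row `a`; this fixes `a` and forces `c = 1`. The
columns of the unit vectors then read off the signs `(-1)^(b e)`. -/
lemma eq_of_weylOp_eq_smul {a b a' b' : E → ZMod 2} {c : ℂ}
    (h : weylOp a b = c • weylOp a' b') : a = a' ∧ b = b' := by
  have key : ∀ x y : E → ZMod 2, (weylOp a b).entry x y = c * (weylOp a' b').entry x y :=
    fun x y => by rw [h, QubitOp.entry_smul]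
  have h0 := key a 0
  rw [entry_weylOp_self_zero, entry_weylOp] at h0
  have ha : a = a' := by
    by_contra hne
    rw [if_neg (by rwa [zero_add]), mul_zero] at h0
    exact one_ne_zero h0
  subst ha
  rw [if_pos (zero_add a).symm, dotProduct_zero, AddChar.map_zero_eq_one, mul_one] at h0
  refine ⟨rfl, funext fun e => ?_⟩
  have h1 := key (Pi.single e 1 + a) (Pi.single e 1)
  rw [entry_weylOp, entry_weylOp, if_pos rfl, if_pos rfl, ← h0, one_mul] at h1
  simpa using signChar_injective h1

/-- The two products are multiples of one nonzero operator, so only their signs have to be compared.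
-/
lemma commute_weylOp_iff (a b a' b' : E → ZMod 2) :
    Commute (weylOp a b) (weylOp a' b') ↔ b ⬝ᵥ a' = b' ⬝ᵥ a := by
  rw [commute_iff_eq, weylOp_mul, weylOp_mul, add_comm a', add_comm b']
  constructor
  · intro h
    exact signChar_injective (smul_left_injective ℂ (weylOp_ne_zero _ _) h)
  · intro h
    rw [h]

end Weyl

/-! ### Pauli operators as Weyl operators -/

namespace Pauli

/-- The exponent of `X`. -/
def xBit : Pauli → ZMod 2
  | I => 0
  | X => 1
  | Y => 1
  | Z => 0

/-- The exponent of `Z`. -/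
def zBit : Pauli → ZMod 2
  | I => 0
  | X => 0
  | Y => 1
  | Z => 1

/-- The scalar `c` in `P = c X^a Z^b`. -/
noncomputable def phase : Pauli → ℂ
  | Y => Complex.I
  | _ => 1

/-- The Pauli matrix proportional to `X^a Z^b`. -/
def ofBits (a b : ZMod 2) : Pauli :=
  if a = 0 then (if b = 0 then I else Z) else (if b = 0 then X else Y)

lemma xBit_ofBits (a b : ZMod 2) : (ofBits a b).xBit = a := by
  revert a b; decide

lemma zBit_ofBits (a b : ZMod 2) : (ofBits a b).zBit = b := by
  revert a b; decide

lemma phase_ne_zero (P : Pauli) : P.phase ≠ 0 := by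
  cases P <;> simp [phase]

lemma eq_I_iff (P : Pauli) : P = I ↔ P.xBit = 0 ∧ P.zBit = 0 := by
  cases P <;> simp [xBit, zBit]

/-- The entries of a Pauli matrix, indexed by `ℤ/2`. -/
noncomputable def entry (P : Pauli) (x y : ZMod 2) : ℂ := P.toMatrix x y

/-- Only `Y = i X Z` carries a nontrivial phase. -/
lemma entry_eq (P : Pauli) (x y : ZMod 2) :
    P.entry x y = P.phase * if x = y + P.xBit then signChar (P.zBit * y) else 0 := by
  rcases ZMod.two_eq_zero_or_one x with rfl | rfl <;>
  rcases ZMod.two_eq_zero_or_one y with rfl | rfl <;>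
  cases P <;>
  simp [phase, xBit, zBit, signChar_one, CharTwo.add_self_eq_zero] <;> rfl

end Pauli

section PauliTensor

variable {E : Type} [Fintype E] [DecidableEq E]

lemma pauliTensor_eq_smul_weylOp (P : E → Pauli) :
    pauliTensor P = (∏ e, (P e).phase) • weylOp (fun e => (P e).xBit) (fun e => (P e).zBit) := by
  refine QubitOp.entry_ext fun x y => ?_
  have h : (pauliTensor P).entry x y = ∏ e, (P e).entry (x e) (y e) := rfl
  rw [h, QubitOp.entry_smul, entry_weylOp]
  simp_rw [Pauli.entry_eq, Finset.prod_mul_distrib]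
  congr 1
  split_ifs with hx
  · rw [dotProduct, signChar_sum]
    refine Finset.prod_congr rfl fun e _ => ?_
    exact if_pos (congrFun hx e)
  · obtain ⟨e, he⟩ := Function.ne_iff.1 hx
    exact Finset.prod_eq_zero (Finset.mem_univ e) (if_neg he)

lemma prod_phase_ne_zero (P : E → Pauli) : ∏ e, (P e).phase ≠ 0 :=
  Finset.prod_ne_zero_iff.2 fun e _ => (P e).phase_ne_zero

lemma weylOp_eq_smul_pauliTensor (a b : E → ZMod 2) :
    weylOp a b = (∏ e, (Pauli.ofBits (a e) (b e)).phase)⁻¹ •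
      pauliTensor fun e => Pauli.ofBits (a e) (b e) := by
  rw [pauliTensor_eq_smul_weylOp, smul_smul, inv_mul_cancel₀ (prod_phase_ne_zero _), one_smul]
  simp_rw [Pauli.xBit_ofBits, Pauli.zBit_ofBits]

lemma mem_pauliGroup_of_eq_weylOp {g : (QubitOp E)ˣ} {a b : E → ZMod 2}
    (h : (g : QubitOp E) = weylOp a b) : g ∈ pauliGroup E := by
  refine ⟨_, _, ?_, h.trans (weylOp_eq_smul_pauliTensor a b)⟩
  rw [← Finset.prod_inv_distrib]
  -- Each factor is the inverse of `1` or `i`, and products stay among the four allowed units.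
  refine Finset.prod_induction _
    (fun c : ℂ => c = 1 ∨ c = -1 ∨ c = Complex.I ∨ c = -Complex.I) ?_ (Or.inl rfl) ?_
  · rintro x y (rfl | rfl | rfl | rfl) (rfl | rfl | rfl | rfl) <;> simp
  · intro e _
    rcases Pauli.ofBits (a e) (b e) <;> simp [Pauli.phase]

lemma pauliTensor_X (a : E → ZMod 2) :
    pauliTensor (fun e => if a e = 1 then Pauli.X else Pauli.I) = weylOp a 0 := by
  rw [pauliTensor_eq_smul_weylOp, Finset.prod_eq_one, one_smul]
  · congr 1 <;> funext e <;> rcases ZMod.two_eq_zero_or_one (a e) with h | h <;>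
      simp [h, Pauli.xBit, Pauli.zBit]
  · intro e _
    split_ifs <;> rfl

lemma pauliTensor_Z (b : E → ZMod 2) :
    pauliTensor (fun e => if b e = 1 then Pauli.Z else Pauli.I) = weylOp 0 b := by
  rw [pauliTensor_eq_smul_weylOp, Finset.prod_eq_one, one_smul]
  · congr 1 <;> funext e <;> rcases ZMod.two_eq_zero_or_one (b e) with h | h <;>
      simp [h, Pauli.xBit, Pauli.zBit]
  · intro e _
    split_ifs <;> rfl

lemma hammingNorm_xBit_le_pauliWeight (P : E → Pauli) :
    hammingNorm (fun e => (P e).xBit) ≤ pauliWeight P := by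
  rw [hammingNorm, pauliWeight, ← Set.ncard_coe_finset]
  refine Set.ncard_le_ncard (fun e he => ?_) (Set.toFinite _)
  rw [Finset.mem_coe, Finset.mem_filter_univ] at he
  exact fun h => he ((Pauli.eq_I_iff _).1 h).1

lemma hammingNorm_zBit_le_pauliWeight (P : E → Pauli) :
    hammingNorm (fun e => (P e).zBit) ≤ pauliWeight P := by
  rw [hammingNorm, pauliWeight, ← Set.ncard_coe_finset]
  refine Set.ncard_le_ncard (fun e he => ?_) (Set.toFinite _)
  rw [Finset.mem_coe, Finset.mem_filter_univ] at he
  exact fun h => he ((Pauli.eq_I_iff _).1 h).2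

lemma pauliWeight_Z (b : E → ZMod 2) :
    pauliWeight (fun e => if b e = 1 then Pauli.Z else Pauli.I) = hammingNorm b := by
  rw [hammingNorm, pauliWeight, ← Set.ncard_coe_finset]
  congr 1
  ext e
  rcases ZMod.two_eq_zero_or_one (b e) with h | h <;> simp [h]

end PauliTensor

/-! ### Calderbank–Shor–Steane codes -/

section CSS

variable {A B E : Type} [Fintype E] [DecidableEq E]
  {HX : Matrix A E (ZMod 2)} {HZ : Matrix B E (ZMod 2)}

/-- The span of the rows of a check matrix. -/
def rowSpace (H : Matrix A E (ZMod 2)) : Submodule (ZMod 2) (E → ZMod 2) :=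
  Submodule.span (ZMod 2) (Set.range H.row)

lemma dotProduct_eq_zero_of_mem_rowSpace {H : Matrix A E (ZMod 2)} {b x : E → ZMod 2}
    (hb : b ∈ rowSpace H) (hx : H *ᵥ x = 0) : b ⬝ᵥ x = 0 := by
  induction hb using Submodule.span_induction with
  | mem b h => obtain ⟨i, rfl⟩ := h; exact congrFun hx i
  | zero => exact zero_dotProduct x
  | add b b' _ _ h h' => rw [add_dotProduct, h, h', add_zero]
  | smul c b _ h => rw [smul_dotProduct, h, smul_zero]

lemma mulVec_eq_zero_of_mem_rowSpace (h : HX * HZᵀ = 0) {a : E → ZMod 2}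
    (ha : a ∈ rowSpace HX) : HZ *ᵥ a = 0 := by
  funext j
  rw [Matrix.mulVec, dotProduct_comm]
  refine dotProduct_eq_zero_of_mem_rowSpace ha ?_
  funext i
  exact congrFun (congrFun h i) j

/-- The two row spaces are orthogonal, so every sign in `weylOp_mul` is trivial and operators of
this form, with no scalar in front, are closed under products and inverses. -/
lemma exists_weylOp_of_mem_checkStabilizer (h : HX * HZᵀ = 0) {g : (QubitOp E)ˣ}
    (hg : g ∈ checkStabilizer HX HZ) :
    ∃ a ∈ rowSpace HX, ∃ b ∈ rowSpace HZ, (g : QubitOp E) = weylOp a b := by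
  have hperp : ∀ a ∈ rowSpace HX, ∀ b ∈ rowSpace HZ, b ⬝ᵥ a = 0 := fun a ha b hb =>
    dotProduct_eq_zero_of_mem_rowSpace hb (mulVec_eq_zero_of_mem_rowSpace h ha)
  induction hg using Subgroup.closure_induction with
  | mem g hg =>
    rcases hg with ⟨i, hi⟩ | ⟨i, hi⟩
    · exact ⟨HX.row i, Submodule.subset_span ⟨i, rfl⟩, 0, zero_mem _,
        hi.trans (pauliTensor_X (HX i))⟩
    · exact ⟨0, zero_mem _, HZ.row i, Submodule.subset_span ⟨i, rfl⟩,
        hi.trans (pauliTensor_Z (HZ i))⟩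
  | one => exact ⟨0, zero_mem _, 0, zero_mem _, weylOp_zero.symm⟩
  | mul g g' _ _ hg hg' =>
    obtain ⟨a, ha, b, hb, hg⟩ := hg
    obtain ⟨a', ha', b', hb', hg'⟩ := hg'
    refine ⟨a + a', add_mem ha ha', b + b', add_mem hb hb', ?_⟩
    rw [Units.val_mul, hg, hg', weylOp_mul, hperp a' ha' b hb, AddChar.map_zero_eq_one, one_smul]
  | inv g _ hg =>
    obtain ⟨a, ha, b, hb, hg⟩ := hg
    refine ⟨a, ha, b, hb, ?_⟩
    rw [← hg]
    refine Units.inv_eq_of_mul_eq_one_right ?_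
    rw [hg]
    exact weylOp_mul_self (hperp a ha b hb)

lemma exists_mem_checkStabilizer_X (HZ : Matrix B E (ZMod 2)) (i : A) :
    ∃ g ∈ checkStabilizer HX HZ, (g : QubitOp E) = weylOp (HX i) 0 :=
  ⟨⟨weylOp (HX i) 0, weylOp (HX i) 0, weylOp_mul_self (zero_dotProduct _),
    weylOp_mul_self (zero_dotProduct _)⟩,
    Subgroup.subset_closure (Or.inl ⟨i, (pauliTensor_X (HX i)).symm⟩), rfl⟩

lemma exists_mem_checkStabilizer_Z (HX : Matrix A E (ZMod 2)) (i : B) :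
    ∃ g ∈ checkStabilizer HX HZ, (g : QubitOp E) = weylOp 0 (HZ i) :=
  ⟨⟨weylOp 0 (HZ i), weylOp 0 (HZ i), weylOp_mul_self (dotProduct_zero _),
    weylOp_mul_self (dotProduct_zero _)⟩,
    Subgroup.subset_closure (Or.inr ⟨i, (pauliTensor_Z (HZ i)).symm⟩), rfl⟩

lemma isStabilizerGroup_checkStabilizer (h : HX * HZᵀ = 0) :
    IsStabilizerGroup (checkStabilizer HX HZ) := by
  refine ⟨fun g hg => ?_, fun hg => ?_⟩
  · obtain ⟨a, -, b, -, hab⟩ := exists_weylOp_of_mem_checkStabilizer h hg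
    exact mem_pauliGroup_of_eq_weylOp hab
  · obtain ⟨a, -, b, -, hab⟩ := exists_weylOp_of_mem_checkStabilizer h hg
    have h1 : weylOp a b = (-1 : ℂ) • weylOp 0 0 := by
      rw [← hab, weylOp_zero, Units.val_neg, Units.val_one, neg_one_smul]
    obtain ⟨rfl, rfl⟩ := eq_of_weylOp_eq_smul h1
    have h2 := entry_weylOp_self_zero (E := E) 0 0
    rw [h1, QubitOp.entry_smul, entry_weylOp_self_zero] at h2
    norm_num at h2

/-- An X-check translates the argument of a state; a Z-check multiplies the value at `x` by the sign
of one coordinate of `HZ *ᵥ x`, which kills the value when that sign is `-1`. -/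
lemma mem_stabilizerCode_checkStabilizer_iff (h : HX * HZᵀ = 0) (ψ : (E → ZMod 2) → ℂ) :
    ψ ∈ stabilizerCode (checkStabilizer HX HZ) ↔
      (∀ a ∈ rowSpace HX, ∀ x, ψ (x + a) = ψ x) ∧ ∀ x, HZ *ᵥ x ≠ 0 → ψ x = 0 := by
  constructor
  · intro hψ
    refine ⟨fun a ha => ?_, fun x hx => ?_⟩
    · induction ha using Submodule.span_induction with
      | mem a h =>
        obtain ⟨i, rfl⟩ := h
        intro x
        obtain ⟨g, hg, hgi⟩ := exists_mem_checkStabilizer_X (HX := HX) HZ i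
        have h1 : (weylOp (HX i) 0).act ψ x = ψ x := by
          rw [← hgi]; exact congrFun (hψ g hg) x
        rwa [act_weylOp, zero_dotProduct, AddChar.map_zero_eq_one, one_mul] at h1
      | zero => intro x; rw [add_zero]
      | add a a' _ _ h h' => intro x; rw [← add_assoc, h', h]
      | smul c a _ h =>
        intro x
        rcases ZMod.two_eq_zero_or_one c with rfl | rfl
        · rw [zero_smul, add_zero]
        · rw [one_smul, h]
    · obtain ⟨i, hi⟩ := Function.ne_iff.1 hx
      obtain ⟨g, hg, hgi⟩ := exists_mem_checkStabilizer_Z (HZ := HZ) HX i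
      have h1 : (weylOp 0 (HZ i)).act ψ x = ψ x := by
        rw [← hgi]; exact congrFun (hψ g hg) x
      have h2 : HZ i ⬝ᵥ x = 1 := (ZMod.two_eq_zero_or_one _).resolve_left hi
      rw [act_weylOp, add_zero, h2, signChar_one] at h1
      linear_combination (-1 / 2 : ℂ) * h1
  · rintro ⟨h1, h2⟩ g hg
    obtain ⟨a, ha, b, hb, hab⟩ := exists_weylOp_of_mem_checkStabilizer h hg
    rw [hab]
    refine funext fun (x : E → ZMod 2) => (act_weylOp a b ψ x).trans ?_
    rw [h1 a ha]
    by_cases hx : HZ *ᵥ x = 0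
    · rw [dotProduct_eq_zero_of_mem_rowSpace hb, AddChar.map_zero_eq_one, one_mul]
      rw [Matrix.mulVec_add, hx, mulVec_eq_zero_of_mem_rowSpace h ha, add_zero]
    · rw [h2 x hx, mul_zero]

/-! ### Dimension and distance of the code -/

open Classical in
/-- The state on `ker HZ` determined by a function on the quotient by a subspace, extended by
zero. -/
noncomputable def quotientState (C R : Submodule (ZMod 2) (E → ZMod 2)) :
    ((C ⧸ R.comap C.subtype) → ℂ) →ₗ[ℂ] ((E → ZMod 2) → ℂ) where
  toFun f x := if hx : x ∈ C then f (Submodule.Quotient.mk ⟨x, hx⟩) else 0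
  map_add' f f' := by
    funext x
    by_cases hx : x ∈ C <;> simp [hx]
  map_smul' c f := by
    funext x
    by_cases hx : x ∈ C <;> simp [hx]

lemma quotientState_apply {C R : Submodule (ZMod 2) (E → ZMod 2)}
    (f : (C ⧸ R.comap C.subtype) → ℂ) (x : C) :
    quotientState C R f x = f (Submodule.Quotient.mk x) := by
  simp [quotientState]

lemma quotientState_injective (C R : Submodule (ZMod 2) (E → ZMod 2)) :
    Function.Injective (quotientState C R) := by
  intro f f' hff
  funext q
  obtain ⟨x, rfl⟩ := Submodule.Quotient.mk_surjective _ q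
  rw [← quotientState_apply f, hff, quotientState_apply f']

/-- Code states are functions on the quotient of `ker HZ` by the row space of `HX`, so the dimension
of the code is the number of elements of that homology group. -/
lemma range_quotientState (h : HX * HZᵀ = 0) :
    LinearMap.range (quotientState (LinearMap.ker HZ.mulVecLin) (rowSpace HX)) =
      stabilizerCode (checkStabilizer HX HZ) := by
  refine Submodule.ext fun (ψ : (E → ZMod 2) → ℂ) => ?_
  refine Iff.trans ?_ (mem_stabilizerCode_checkStabilizer_iff h ψ).symm
  have hR : ∀ a ∈ rowSpace HX, a ∈ LinearMap.ker HZ.mulVecLin := fun a ha =>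
    mulVec_eq_zero_of_mem_rowSpace h ha
  constructor
  · rintro ⟨f, rfl⟩
    refine ⟨fun a ha x => ?_, fun x hx => dif_neg hx⟩
    by_cases hx : x ∈ LinearMap.ker HZ.mulVecLin
    · have hxa := add_mem hx (hR a ha)
      refine (quotientState_apply f ⟨_, hxa⟩).trans
        (Eq.trans ?_ (quotientState_apply f ⟨x, hx⟩).symm)
      congr 1
      rw [Submodule.Quotient.eq]
      simpa using ha
    · have hxa : x + a ∉ LinearMap.ker HZ.mulVecLin := fun hxa =>
        hx (by simpa using sub_mem hxa (hR a ha))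
      exact Eq.trans (dif_neg hxa) (Eq.symm (dif_neg hx) : 0 = quotientState _ _ f x)
  · rintro ⟨h1, h2⟩
    -- The invariance `h1` makes the value independent of the representative chosen by
    -- `Quotient.out`.
    refine ⟨fun q => ψ (Quotient.out q : LinearMap.ker HZ.mulVecLin), ?_⟩
    funext x
    by_cases hx : x ∈ LinearMap.ker HZ.mulVecLin
    · refine (quotientState_apply _ ⟨x, hx⟩).trans ?_
      set q : (LinearMap.ker HZ.mulVecLin) ⧸ (rowSpace HX).comap (LinearMap.ker HZ.mulVecLin).subtype :=
        Submodule.Quotient.mk ⟨x, hx⟩ with hq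
      have h3 : Submodule.Quotient.mk (Quotient.out q) = q := Quotient.out_eq q
      rw [hq, Submodule.Quotient.eq] at h3
      have h4 := h1 _ h3 x
      rw [← h4]
      congr 1
      simp [hq]
    · exact (dif_neg hx).trans (h2 x hx).symm

lemma finrank_stabilizerCode_checkStabilizer [Fintype A] [Fintype B] (h : HX * HZᵀ = 0) :
    Module.finrank ℂ (stabilizerCode (checkStabilizer HX HZ)) =
      2 ^ (Fintype.card E - HX.rank - HZ.rank) := by
  rw [← range_quotientState h]
  refine (LinearMap.finrank_range_of_inj (quotientState_injective _ _)).trans ?_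
  set C := LinearMap.ker HZ.mulVecLin
  have hle : rowSpace HX ≤ C := fun a ha => mulVec_eq_zero_of_mem_rowSpace h ha
  have : Finite (C ⧸ (rowSpace HX).comap C.subtype) :=
    Finite.of_surjective _ (Submodule.Quotient.mk_surjective _)
  have : Fintype (C ⧸ (rowSpace HX).comap C.subtype) := Fintype.ofFinite _
  rw [Module.finrank_pi, ← Nat.card_eq_fintype_card, Module.natCard_eq_pow_finrank (K := ZMod 2),
    Nat.card_zmod]
  congr 1
  have h1 := Submodule.finrank_quotient_add_finrank ((rowSpace HX).comap C.subtype)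
  have h2 := (Submodule.comapSubtypeEquivOfLe hle).finrank_eq
  have h3 := LinearMap.finrank_range_add_finrank_ker HZ.mulVecLin
  have h4 : HX.rank = Module.finrank (ZMod 2) (rowSpace HX) := HX.rank_eq_finrank_span_row
  have h5 : HZ.rank = Module.finrank (ZMod 2) (LinearMap.range HZ.mulVecLin) := rfl
  rw [Module.finrank_fintype_fun_eq_card] at h3
  change _ + Module.finrank (ZMod 2) C = _ at h3
  omega

/-- A code whose check matrices have kernels of minimum weight at least `d`, with a nontrivial
cycle of weight `d`, has distance `d`. -/
theorem isQuantumCode_checkStabilizer [Fintype A] [Fintype B] (h : HX * HZᵀ = 0) {d : ℕ}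
    (hX : ∀ z, HX *ᵥ z = 0 → z ≠ 0 → d ≤ hammingNorm z)
    (hZ : ∀ z, HZ *ᵥ z = 0 → z ≠ 0 → d ≤ hammingNorm z)
    (hd : ∃ z, HX *ᵥ z = 0 ∧ z ∉ rowSpace HZ ∧ hammingNorm z ≤ d) :
    IsQuantumCode (checkStabilizer HX HZ) (Fintype.card E)
      (Fintype.card E - HX.rank - HZ.rank) d where
  stabilizer := isStabilizerGroup_checkStabilizer h
  length := rfl
  dimension := finrank_stabilizerCode_checkStabilizer h
  distance := by
    constructor
    · obtain ⟨z, hz, hzR, hzd⟩ := hd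
      obtain rfl : hammingNorm z = d :=
        le_antisymm hzd (hX z hz fun h0 => hzR (h0 ▸ zero_mem _))
      refine ⟨fun e => if z e = 1 then Pauli.Z else Pauli.I, pauliWeight_Z z, ?_, ?_⟩
      · intro g hg
        obtain ⟨a, ha, b, hb, hab⟩ := exists_weylOp_of_mem_checkStabilizer h hg
        rw [hab, pauliTensor_Z, commute_weylOp_iff, dotProduct_zero, dotProduct_comm]
        exact dotProduct_eq_zero_of_mem_rowSpace ha hz
      · intro g hg c hgc
        obtain ⟨a, ha, b, hb, hab⟩ := exists_weylOp_of_mem_checkStabilizer h hg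
        rw [hab, pauliTensor_Z] at hgc
        obtain ⟨-, rfl⟩ := eq_of_weylOp_eq_smul hgc
        exact hzR hb
    · rintro w ⟨P, rfl, hcomm, hne⟩
      set x : E → ZMod 2 := fun e => (P e).xBit with hx
      set z : E → ZMod 2 := fun e => (P e).zBit with hz
      have hP := pauliTensor_eq_smul_weylOp P
      have hcomm' : ∀ a b, (∃ g ∈ checkStabilizer HX HZ, (g : QubitOp E) = weylOp a b) →
          z ⬝ᵥ a = b ⬝ᵥ x := by
        rintro a b ⟨g, hg, hgab⟩
        rw [← commute_weylOp_iff]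
        have := hcomm g hg
        rwa [hP, hgab, Commute.smul_left_iff₀ (prod_phase_ne_zero P)] at this
      have hzker : HX *ᵥ z = 0 := by
        funext i
        have := hcomm' _ _ (exists_mem_checkStabilizer_X HZ i)
        rw [zero_dotProduct, dotProduct_comm] at this
        exact this
      have hxker : HZ *ᵥ x = 0 := by
        funext i
        have := hcomm' _ _ (exists_mem_checkStabilizer_Z HX i)
        rw [dotProduct_zero] at this
        exact this.symm
      -- If both parts vanish, `P` is a multiple of the identity, which is in the stabilizer.
      -- Otherwise a nonzero part already has weight at least `d`; whether it lies in a row space is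
      -- irrelevant.
      by_cases hx0 : x = 0
      · by_cases hz0 : z = 0
        · exfalso
          refine hne 1 (one_mem _) (∏ e, (P e).phase)⁻¹ ?_
          rw [hP, smul_smul, inv_mul_cancel₀ (prod_phase_ne_zero P), one_smul, ← hx, ← hz, hx0,
            hz0, weylOp_zero, Units.val_one]
        · exact (hX z hzker hz0).trans (hammingNorm_zBit_le_pauliWeight P)
      · exact (hZ x hxker hx0).trans (hammingNorm_xBit_le_pauliWeight P)

end CSS

/-! ### Incidence matrices of Cayley graphs -/

/-- A nonzero cycle of a triangle-free simple graph has at least four edges. -/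
lemma four_le_hammingNorm_of_triangleFree {V E : Type} [DecidableEq V] [Fintype E]
    (p q : E → V) (hpq : ∀ e, p e ≠ q e)
    (hsimple : ∀ e e' u v, u ≠ v → (u = p e ∨ u = q e) → (v = p e ∨ v = q e) →
      (u = p e' ∨ u = q e') → (v = p e' ∨ v = q e') → e = e')
    (htri : ∀ e₁ e₂ e₃ a b c, a ≠ b → b ≠ c → c ≠ a →
      (a = p e₁ ∨ a = q e₁) → (b = p e₁ ∨ b = q e₁) →
      (b = p e₂ ∨ b = q e₂) → (c = p e₂ ∨ c = q e₂) →
      (c = p e₃ ∨ c = q e₃) → (a = p e₃ ∨ a = q e₃) → False)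
    (z : E → ZMod 2)
    (hz : ∀ v, ∑ e, ((if v = p e then 1 else 0) + (if v = q e then 1 else 0)) * z e = 0)
    (hz0 : z ≠ 0) : 4 ≤ hammingNorm z := by
  classical
  -- The parity condition at `v` forbids exactly one edge of the support there.
  have next : ∀ e v, z e ≠ 0 → (v = p e ∨ v = q e) →
      ∃ e', e' ≠ e ∧ z e' ≠ 0 ∧ (v = p e' ∨ v = q e') := by
    intro e v he hv
    by_contra! hcon
    have h := hz v
    rw [Finset.sum_eq_single e] at h
    · rcases hv with rfl | rfl
      · rw [if_pos rfl, if_neg (hpq e), add_zero, one_mul] at h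
        exact he h
      · rw [if_pos rfl, if_neg (hpq e).symm, zero_add, one_mul] at h
        exact he h
    · intro e' _ hne
      by_cases hze : z e' = 0
      · rw [hze, mul_zero]
      · obtain ⟨h1, h2⟩ := hcon e' hne hze
        rw [if_neg h1, if_neg h2, add_zero, zero_mul]
    · simp
  have other : ∀ e v, (v = p e ∨ v = q e) → ∃ v', v' ≠ v ∧ (v' = p e ∨ v' = q e) := by
    rintro e v (rfl | rfl)
    · exact ⟨q e, (hpq e).symm, Or.inr rfl⟩
    · exact ⟨p e, hpq e, Or.inl rfl⟩
  obtain ⟨e, he⟩ := Function.ne_iff.1 hz0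
  obtain ⟨e₁, h₁e, h₁, ha₁⟩ := next e (p e) he (Or.inl rfl)
  obtain ⟨e₂, h₂e, h₂, hb₂⟩ := next e (q e) he (Or.inr rfl)
  -- The support contains `e₁`, `e`, `e₂` with `e₁` joining `x` to `p e` and `e₂` leaving `q e`. The
  -- edge `e₃` that continues past `x` cannot be `e₂` without closing a triangle.
  obtain ⟨x, hxa, hx₁⟩ := other e₁ _ ha₁
  have hxb : x ≠ q e := by
    rintro rfl
    exact h₁e (hsimple e₁ e _ _ hxa hx₁ ha₁ (Or.inr rfl) (Or.inl rfl))
  have h₁₂ : e₁ ≠ e₂ := by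
    rintro rfl
    exact h₁e (hsimple e₁ e _ _ (hpq e) ha₁ hb₂ (Or.inl rfl) (Or.inr rfl))
  obtain ⟨e₃, h₃₁, h₃, hx₃⟩ := next e₁ x h₁ hx₁
  have h₃e : e₃ ≠ e := by
    rintro rfl
    exact hx₃.elim hxa hxb
  have h₃₂ : e₃ ≠ e₂ := by
    rintro rfl
    exact htri e e₃ e₁ (p e) (q e) x (hpq e) hxb.symm hxa (Or.inl rfl) (Or.inr rfl) hb₂ hx₃
      hx₁ ha₁
  have hcard : ({e, e₁, e₂, e₃} : Finset E).card = 4 := by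
    rw [Finset.card_insert_of_notMem, Finset.card_insert_of_notMem, Finset.card_pair h₃₂.symm]
    · simp [h₁₂, h₃₁.symm]
    · simp [h₁e.symm, h₂e.symm, h₃e.symm]
  rw [← hcard]
  refine Finset.card_le_card fun x hx => ?_
  simp only [Finset.mem_insert, Finset.mem_singleton] at hx
  rw [Finset.mem_filter_univ]
  rcases hx with rfl | rfl | rfl | rfl <;> assumption

section Cayley

variable {G : Type} [AddCommGroup G] [DecidableEq G] {m : ℕ}

/-- The incidence matrix of the Cayley graph with steps `D s`, where the edge `(w, s)` joins
`w + t s` to `w + t s + D s`. -/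
def cayleyIncidence (D t : Fin m → G) : Matrix G (G × Fin m) (ZMod 2) :=
  Matrix.of fun v e =>
    (if v = e.1 + t e.2 then 1 else 0) + (if v = e.1 + t e.2 + D e.2 then 1 else 0)

lemma cayleyIncidence_apply (D t : Fin m → G) (v : G) (e : G × Fin m) :
    cayleyIncidence D t v e =
      (if v = e.1 + t e.2 then 1 else 0) + (if v = e.1 + t e.2 + D e.2 then 1 else 0) := rfl

variable [Fintype G]

lemma vecMul_cayleyIncidence (D t : Fin m → G) (f : G → ZMod 2) (e : G × Fin m) :
    (f ᵥ* cayleyIncidence D t) e = f (e.1 + t e.2) + f (e.1 + t e.2 + D e.2) := by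
  simp [Matrix.vecMul, dotProduct, cayleyIncidence_apply, mul_add, Finset.sum_add_distrib]

/-- A function in the left kernel is invariant under `D s₀`, which generates the group, so the left
kernel consists of the constants. -/
lemma rank_cayleyIncidence (D t : Fin m → G) (s₀ : Fin m) (hgen : ∀ x, ∃ n : ℕ, n • D s₀ = x) :
    (cayleyIncidence D t).rank = Fintype.card G - 1 := by
  have hker : LinearMap.ker (cayleyIncidence D t)ᵀ.mulVecLin =
      Submodule.span (ZMod 2) {(1 : G → ZMod 2)} := by
    ext f
    rw [LinearMap.mem_ker, Matrix.mulVecLin_apply, Matrix.mulVec_transpose,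
      Submodule.mem_span_singleton]
    constructor
    · intro hf
      have hstep : ∀ w, f (w + D s₀) = f w := fun w => by
        have h := congrFun hf (w - t s₀, s₀)
        rw [vecMul_cayleyIncidence, sub_add_cancel, Pi.zero_apply, CharTwo.add_eq_zero] at h
        exact h.symm
      refine ⟨f 0, funext fun x => ?_⟩
      obtain ⟨n, rfl⟩ := hgen x
      rw [Pi.smul_apply, Pi.one_apply, smul_eq_mul, mul_one]
      induction n with
      | zero => rw [zero_smul]
      | succ n ih => rw [succ_nsmul, hstep, ih]
    · rintro ⟨c, rfl⟩
      funext e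
      rw [vecMul_cayleyIncidence]
      exact CharTwo.add_self_eq_zero _
  have h := LinearMap.finrank_range_add_finrank_ker (cayleyIncidence D t)ᵀ.mulVecLin
  rw [hker, finrank_span_singleton one_ne_zero, Module.finrank_fintype_fun_eq_card] at h
  rw [← Matrix.rank_transpose]
  exact Nat.eq_sub_of_add_eq h

/-- The steps of a Cayley graph with their signs. -/
def signedSteps (D : Fin m → G) : Set G := {x | ∃ s, x = D s ∨ x = -D s}

/-- By `hinj` and `hneg` an edge determines its label, so the graph is simple; the sides of a
triangle would be signed steps with sum zero. The shift `t` only relabels edges, so one bound serves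
both check matrices. -/
lemma four_le_hammingNorm_of_cayleyIncidence (D t : Fin m → G) (hinj : Function.Injective D)
    (hneg : ∀ s s', D s ≠ -D s')
    (htri : ∀ x ∈ signedSteps D, ∀ y ∈ signedSteps D, ∀ w ∈ signedSteps D, x + y + w ≠ 0)
    (z : G × Fin m → ZMod 2) (hz : cayleyIncidence D t *ᵥ z = 0) (hz0 : z ≠ 0) :
    4 ≤ hammingNorm z := by
  have hD : ∀ s, D s ≠ 0 := fun s h => hneg s s (by rw [h, neg_zero])
  have hstep : ∀ (e : G × Fin m) (u v : G), u ≠ v →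
      (u = e.1 + t e.2 ∨ u = e.1 + t e.2 + D e.2) → (v = e.1 + t e.2 ∨ v = e.1 + t e.2 + D e.2) →
      (u = e.1 + t e.2 ∧ v - u = D e.2) ∨ (v = e.1 + t e.2 ∧ v - u = -D e.2) := by
    rintro e u v huv (rfl | rfl) (rfl | rfl)
    · exact absurd rfl huv
    · exact Or.inl ⟨rfl, by abel⟩
    · exact Or.inr ⟨rfl, by abel⟩
    · exact absurd rfl huv
  have hmem : ∀ (e : G × Fin m) (u v : G), u ≠ v →
      (u = e.1 + t e.2 ∨ u = e.1 + t e.2 + D e.2) → (v = e.1 + t e.2 ∨ v = e.1 + t e.2 + D e.2) →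
      v - u ∈ signedSteps D := fun e u v huv hu hv =>
    ⟨e.2, (hstep e u v huv hu hv).imp (·.2) (·.2)⟩
  refine four_le_hammingNorm_of_triangleFree (fun e : G × Fin m => e.1 + t e.2)
    (fun e => e.1 + t e.2 + D e.2) (fun e he => hD e.2 (left_eq_add.1 he)) ?_ ?_ z
    (fun v => congrFun hz v) hz0
  · rintro ⟨w, s⟩ ⟨w', s'⟩ u v huv hu hv hu' hv'
    rcases hstep _ u v huv hu hv with ⟨h1, h2⟩ | ⟨h1, h2⟩ <;>
    rcases hstep _ u v huv hu' hv' with ⟨h1', h2'⟩ | ⟨h1', h2'⟩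
    · obtain rfl : s = s' := hinj (h2.symm.trans h2')
      obtain rfl : w = w' := add_right_cancel (h1.symm.trans h1')
      rfl
    · exact absurd (h2.symm.trans h2') (hneg s s')
    · exact absurd (h2'.symm.trans h2) (hneg s' s)
    · obtain rfl : s = s' := hinj (neg_injective (h2.symm.trans h2'))
      obtain rfl : w = w' := add_right_cancel (h1.symm.trans h1')
      rfl
  · intro e₁ e₂ e₃ a b c hab hbc hca h1 h2 h3 h4 h5 h6
    refine htri _ (hmem e₁ a b hab h1 h2) _ (hmem e₂ b c hbc h3 h4) _ (hmem e₃ c a hca h5 h6) ?_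
    abel

end Cayley

/-! ### Cyclic polygon systems -/

/-- The system of all translates of one `2m`-gon `(c 0, …, c (2m - 1))` in an abelian group. -/
def cyclicPolygons {G : Type} [AddCommGroup G] (m : ℕ) (c : ℕ → G) : PolygonSystem G G where
  len _ := 2 * m
  vert j i := j + c i.val

/-- The polygon `(c 0, …, c (2m - 1))` is closed, its successive steps are
`D 0, D 0, D 1, D 1, …, D (m - 1), D (m - 1)`, its corners are distinct, and the Cayley graph
with steps `± D s` is simple, connected and without triangles. -/
structure IsDoubledStepPolygon {G : Type} [AddCommGroup G] (m : ℕ) (D c : ℕ → G) : Prop where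
  three_le : 3 ≤ m
  corner_zero : c 0 = 0
  corner_odd : ∀ s < m, c (2 * s + 1) = c (2 * s) + D s
  corner_even : ∀ s < m, c (2 * s + 2) = c (2 * s + 1) + D s
  corner_two_mul : c (2 * m) = 0
  corner_inj : ∀ i < 2 * m, ∀ j < 2 * m, c i = c j → i = j
  step_inj : ∀ i < m, ∀ j < m, D i = D j → i = j
  step_ne_neg : ∀ i < m, ∀ j < m, D i ≠ -D j
  generates : ∀ x, ∃ n : ℕ, n • D 0 = x
  triangleFree : ∀ x ∈ signedSteps (fun s : Fin m => D s), ∀ y ∈ signedSteps (fun s : Fin m => D s),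
    ∀ z ∈ signedSteps (fun s : Fin m => D s), x + y + z ≠ 0

namespace IsDoubledStepPolygon

/-! ### Incidences of vertices, edges and faces -/

variable {G : Type} [AddCommGroup G] {m : ℕ} {D c : ℕ → G}

lemma step_ne_zero (h : IsDoubledStepPolygon m D c) {s : ℕ} (hs : s < m) : D s ≠ 0 := fun h0 =>
  h.step_ne_neg s hs s hs (by rw [h0, neg_zero])

lemma corner_val_succ (h : IsDoubledStepPolygon m D c) (i : ZMod (2 * m)) :
    c (i + 1).val = c (i.val + 1) := by
  have hm := h.three_le
  have : NeZero (2 * m) := ⟨by omega⟩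
  have : Fact (1 < 2 * m) := ⟨by omega⟩
  have hi := ZMod.val_lt i
  rw [ZMod.val_add, ZMod.val_one]
  rcases Nat.lt_or_ge (i.val + 1) (2 * m) with h1 | h1
  · rw [Nat.mod_eq_of_lt h1]
  · rw [show i.val + 1 = 2 * m by omega, Nat.mod_self, h.corner_zero, h.corner_two_mul]

lemma exists_val_iff (h : IsDoubledStepPolygon m D c) (p : ℕ → Prop) :
    (∃ i : ZMod (2 * m), p i.val) ↔ ∃ t < 2 * m, p t := by
  have hm := h.three_le
  have : NeZero (2 * m) := ⟨by omega⟩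
  constructor
  · rintro ⟨i, hi⟩
    exact ⟨i.val, ZMod.val_lt i, hi⟩
  · rintro ⟨t, ht, hp⟩
    exact ⟨t, by rwa [ZMod.val_natCast, Nat.mod_eq_of_lt ht]⟩

lemma mem_verts_iff (h : IsDoubledStepPolygon m D c) (v j : G) :
    v ∈ (cyclicPolygons m c).verts j ↔ ∃ t < 2 * m, v = j + c t := by
  rw [← h.exists_val_iff fun t => v = j + c t]
  exact exists_congr fun i => eq_comm

lemma mem_boundary_iff (h : IsDoubledStepPolygon m D c) (e : Sym2 G) (j : G) :
    e ∈ (cyclicPolygons m c).boundary j ↔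
      ∃ s < m, e = s(j + c (2 * s), j + c (2 * s) + D s) ∨
        e = s(j + c (2 * s + 1), j + c (2 * s + 1) + D s) := by
  have h1 : e ∈ (cyclicPolygons m c).boundary j ↔ ∃ t < 2 * m, e = s(j + c t, j + c (t + 1)) := by
    rw [← h.exists_val_iff fun t => e = s(j + c t, j + c (t + 1))]
    refine exists_congr fun (i : ZMod (2 * m)) => ?_
    rw [← h.corner_val_succ]
    exact eq_comm
  rw [h1]
  constructor
  · rintro ⟨t, ht, rfl⟩
    rcases Nat.even_or_odd' t with ⟨s, rfl | rfl⟩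
    · exact ⟨s, by omega, Or.inl (by rw [h.corner_odd s (by omega), add_assoc])⟩
    · exact ⟨s, by omega, Or.inr (by rw [h.corner_even s (by omega), add_assoc])⟩
  · rintro ⟨s, hs, rfl | rfl⟩
    · exact ⟨2 * s, by omega, by rw [h.corner_odd s hs, add_assoc]⟩
    · exact ⟨2 * s + 1, by omega, by rw [h.corner_even s hs, add_assoc]⟩

lemma edge_eq_iff (h : IsDoubledStepPolygon m D c) {w w' : G} {s s' : ℕ} (hs : s < m)
    (hs' : s' < m) : s(w, w + D s) = s(w', w' + D s') ↔ w = w' ∧ s = s' := by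
  constructor
  · rw [Sym2.eq_iff]
    rintro (⟨rfl, h2⟩ | ⟨rfl, h2⟩)
    · exact ⟨rfl, h.step_inj s hs s' hs' (add_left_cancel h2)⟩
    · refine absurd ?_ (h.step_ne_neg s hs s' hs')
      rw [add_assoc, add_eq_left] at h2
      rw [eq_neg_iff_add_eq_zero, add_comm, h2]
  · rintro ⟨rfl, rfl⟩
    rfl

/-- Each step occurs exactly twice along the polygon, at corners `2s` and `2s + 1`, so each edge
lies on just two faces. -/
lemma edge_mem_boundary_iff (h : IsDoubledStepPolygon m D c) {w j : G} {s : ℕ} (hs : s < m) :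
    s(w, w + D s) ∈ (cyclicPolygons m c).boundary j ↔
      w = j + c (2 * s) ∨ w = j + c (2 * s + 1) := by
  rw [h.mem_boundary_iff]
  constructor
  · rintro ⟨s', hs', he | he⟩ <;> rw [h.edge_eq_iff hs hs'] at he <;> obtain ⟨rfl, rfl⟩ := he
    · exact Or.inl rfl
    · exact Or.inr rfl
  · rintro (rfl | rfl)
    · exact ⟨s, hs, Or.inl rfl⟩
    · exact ⟨s, hs, Or.inr rfl⟩

lemma edge_mem_edgeSet (h : IsDoubledStepPolygon m D c) (w : G) {s : ℕ} (hs : s < m) :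
    s(w, w + D s) ∈ (cyclicPolygons m c).edgeSet :=
  ⟨w - c (2 * s), (h.edge_mem_boundary_iff hs).2 (Or.inl (by abel))⟩

/-- Every edge is `{w, w + D s}` for a unique pair `(w, s)`. -/
noncomputable def edgeEquiv (h : IsDoubledStepPolygon m D c) :
    G × Fin m ≃ (cyclicPolygons m c).Edge :=
  Equiv.ofBijective (fun p => ⟨s(p.1, p.1 + D p.2), h.edge_mem_edgeSet p.1 p.2.2⟩) <| by
    constructor
    · rintro ⟨w, s⟩ ⟨w', s'⟩ he
      obtain ⟨h1, h2⟩ := (h.edge_eq_iff s.2 s'.2).1 (congrArg Subtype.val he)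
      exact Prod.ext h1 (Fin.ext h2)
    · rintro ⟨e, j, he⟩
      obtain ⟨s, hs, rfl | rfl⟩ := (h.mem_boundary_iff e j).1 he
      · exact ⟨(_, ⟨s, hs⟩), rfl⟩
      · exact ⟨(_, ⟨s, hs⟩), rfl⟩

lemma edgeEquiv_coe (h : IsDoubledStepPolygon m D c) (p : G × Fin m) :
    (h.edgeEquiv p).1 = s(p.1, p.1 + D p.2) := rfl

/-! ### The map -/

/-- The faces at `v` are `v - c t`. Going from `t` to `t + 1` crosses the edge from `v` to `v + D s`
if `t = 2s`, and to `v - D s` if `t = 2s + 1`; so the neighbours come in the order `D 0, -D 0, D 1,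
-D 1, …`. -/
lemma faceCycleAt (h : IsDoubledStepPolygon m D c) (v : G) :
    (cyclicPolygons m c).FaceCycleAt v (2 * m) := by
  have hm := h.three_le
  have : NeZero (2 * m) := ⟨by omega⟩
  have : Fact (1 < 2 * m) := ⟨by omega⟩
  set u : ℕ → G := fun t =>
    if t = 0 then -D (m - 1) else if t % 2 = 1 then D (t / 2) else -D (t / 2 - 1) with hu
  have hu_odd : ∀ s, u (2 * s + 1) = D s := fun s => by
    simp only [hu]
    rw [if_neg (by omega), if_pos (by omega)]
    congr 1; omega
  have hu_even : ∀ s, u (2 * s + 2) = -D s := fun s => by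
    simp only [hu]
    rw [if_neg (by omega), if_neg (by omega)]
    congr 2; omega
  have hu_zero : u 0 = -D (m - 1) := if_pos rfl
  -- Index `0` is treated as `2m`, which puts `-D (m - 1)` in line with the other even indices.
  have hcases : ∀ t < 2 * m, ∃ s < m, (t = 2 * s + 1 ∧ u t = D s) ∨
      (t % (2 * m) = (2 * s + 2) % (2 * m) ∧ u t = -D s) := by
    intro t ht
    rcases Nat.eq_zero_or_pos t with rfl | h0
    · refine ⟨m - 1, by omega, Or.inr ⟨?_, hu_zero⟩⟩
      rw [show 2 * (m - 1) + 2 = 2 * m by omega, Nat.mod_self, Nat.zero_mod]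
    · rcases Nat.even_or_odd' t with ⟨s, rfl | rfl⟩
      · obtain ⟨s, rfl⟩ : ∃ r, s = r + 1 := ⟨s - 1, by omega⟩
        exact ⟨s, by omega, Or.inr ⟨rfl, hu_even s⟩⟩
      · exact ⟨s, by omega, Or.inl ⟨rfl, hu_odd s⟩⟩
  have hu_inj : ∀ t < 2 * m, ∀ t' < 2 * m, u t = u t' → t = t' := by
    intro t ht t' ht' huu
    obtain ⟨s, hs, ⟨h1, h2⟩ | ⟨h1, h2⟩⟩ := hcases t ht <;>
    obtain ⟨s', hs', ⟨h1', h2'⟩ | ⟨h1', h2'⟩⟩ := hcases t' ht' <;>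
    rw [h2, h2'] at huu
    · rw [h1, h1', h.step_inj s hs s' hs' huu]
    · exact absurd huu (h.step_ne_neg s hs s' hs')
    · exact absurd huu.symm (h.step_ne_neg s' hs' s hs)
    · rw [← Nat.mod_eq_of_lt ht, ← Nat.mod_eq_of_lt ht', h1, h1',
        h.step_inj s hs s' hs' (neg_injective huu)]
  have hu_succ : ∀ i : ZMod (2 * m), u (i + 1).val = u (i.val + 1) := by
    intro i
    have hi := ZMod.val_lt i
    rw [ZMod.val_add, ZMod.val_one]
    rcases Nat.lt_or_ge (i.val + 1) (2 * m) with h1 | h1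
    · rw [Nat.mod_eq_of_lt h1]
    · rw [show i.val + 1 = 2 * (m - 1) + 2 by omega, hu_even,
        show 2 * (m - 1) + 2 = 2 * m by omega, Nat.mod_self, hu_zero]
  have hedge : ∀ t < 2 * m, s(v, v + u (t + 1)) ∈ (cyclicPolygons m c).boundary (v - c t) ∧
      s(v, v + u (t + 1)) ∈ (cyclicPolygons m c).boundary (v - c (t + 1)) := by
    intro t ht
    rcases Nat.even_or_odd' t with ⟨s, rfl | rfl⟩
    · have hs : s < m := by omega
      rw [hu_odd, h.edge_mem_boundary_iff hs, h.edge_mem_boundary_iff hs]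
      exact ⟨Or.inl (by abel), Or.inr (by abel)⟩
    · have hs : s < m := by omega
      have he : s(v, v + -D s) = s(v - D s, v - D s + D s) := by
        rw [sub_add_cancel, ← sub_eq_add_neg, Sym2.eq_swap]
      rw [hu_even, he, h.edge_mem_boundary_iff hs, h.edge_mem_boundary_iff hs,
        h.corner_even s hs, h.corner_odd s hs]
      exact ⟨Or.inl (by abel), Or.inr (by abel)⟩
  refine ⟨fun i => v + u i.val, fun i => v - c i.val, ?_, ?_, ?_, ?_⟩
  · intro i i' hii
    exact ZMod.val_injective _
      (hu_inj _ (ZMod.val_lt i) _ (ZMod.val_lt i') (add_left_cancel hii))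
  · intro i i' hii
    exact ZMod.val_injective _
      (h.corner_inj _ (ZMod.val_lt i) _ (ZMod.val_lt i') (sub_right_injective hii))
  · intro f
    rw [h.mem_verts_iff, h.exists_val_iff fun t => v - c t = f]
    exact exists_congr fun t => and_congr_right fun _ => sub_eq_iff_eq_add.symm
  · intro i
    constructor
    · obtain ⟨k, rfl⟩ : ∃ k, i = k + 1 := ⟨i - 1, by abel⟩
      simp only [hu_succ, h.corner_val_succ]
      exact (hedge _ (ZMod.val_lt k)).2
    · simp only [hu_succ]
      exact (hedge _ (ZMod.val_lt i)).1

lemma connected (h : IsDoubledStepPolygon m D c) :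
    (SimpleGraph.fromEdgeSet (cyclicPolygons m c).edgeSet).Connected := by
  have hm : 0 < m := by have := h.three_le; omega
  have hreach : ∀ x, (SimpleGraph.fromEdgeSet (cyclicPolygons m c).edgeSet).Reachable 0 x := by
    intro x
    obtain ⟨n, rfl⟩ := h.generates x
    induction n with
    | zero => rw [zero_smul]
    | succ n ih =>
      refine ih.trans (SimpleGraph.Adj.reachable ?_)
      rw [succ_nsmul, SimpleGraph.fromEdgeSet_adj]
      exact ⟨h.edge_mem_edgeSet _ hm, fun he => h.step_ne_zero hm (left_eq_add.1 he)⟩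
  exact { preconnected := fun x y => (hreach x).symm.trans (hreach y), nonempty := ⟨0⟩ }

lemma isEquivelar (h : IsDoubledStepPolygon m D c) :
    (cyclicPolygons m c).IsEquivelar (2 * m) (2 * m) := by
  have hm := h.three_le
  have : NeZero (2 * m) := ⟨by omega⟩
  refine ⟨⟨fun _ => ?_, fun f => ?_, h.connected, fun v => ⟨2 * m, by omega, h.faceCycleAt v⟩⟩,
    fun _ => rfl, h.faceCycleAt⟩
  · change 3 ≤ 2 * m
    omega
  · intro (i : ZMod (2 * m)) (i' : ZMod (2 * m)) hii
    exact ZMod.val_injective _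
      (h.corner_inj _ (ZMod.val_lt i) _ (ZMod.val_lt i') (add_left_cancel hii))

/-- The involution of the edges that goes with the duality `v ↔ -v`. -/
noncomputable def dualEdge (h : IsDoubledStepPolygon m D c) :
    (cyclicPolygons m c).Edge ≃ (cyclicPolygons m c).Edge :=
  h.edgeEquiv.permCongr
    { toFun := fun p => (c (2 * (p.2 : ℕ)) - p.1, p.2)
      invFun := fun p => (c (2 * (p.2 : ℕ)) - p.1, p.2)
      left_inv := fun _ => Prod.ext (sub_sub_cancel _ _) rfl
      right_inv := fun _ => Prod.ext (sub_sub_cancel _ _) rfl }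

lemma dualEdge_edgeEquiv (h : IsDoubledStepPolygon m D c) (w : G) (s : Fin m) :
    h.dualEdge (h.edgeEquiv (w, s)) = h.edgeEquiv (c (2 * (s : ℕ)) - w, s) := by
  simp [dualEdge, Equiv.permCongr_apply]

/-- The edge `(w, s)` has ends `w`, `w + D s`, and its image `(c (2s) - w, s)` lies on the faces
`-w` and `-(w + D s)`. -/
lemma isSelfDual (h : IsDoubledStepPolygon m D c) : (cyclicPolygons m c).IsSelfDual := by
  refine ⟨Equiv.neg G, h.dualEdge, Equiv.neg G, ?_, ?_, ?_⟩
  · intro v e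
    obtain ⟨⟨w, s⟩, rfl⟩ := h.edgeEquiv.surjective e
    rw [h.dualEdge_edgeEquiv, h.edgeEquiv_coe, h.edgeEquiv_coe, h.edge_mem_boundary_iff s.2,
      Sym2.mem_iff, h.corner_odd s s.2, Equiv.neg_apply]
    exact or_congr (eq_iff_eq_of_sub_eq_sub (by dsimp only; abel))
      (eq_iff_eq_of_sub_eq_sub (by dsimp only; abel))
  · intro e f
    obtain ⟨⟨w, s⟩, rfl⟩ := h.edgeEquiv.surjective e
    rw [h.dualEdge_edgeEquiv, h.edgeEquiv_coe, h.edgeEquiv_coe, h.edge_mem_boundary_iff s.2,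
      Sym2.mem_iff, h.corner_odd s s.2, Equiv.neg_apply]
    exact or_congr (eq_iff_eq_of_sub_eq_sub (by dsimp only; abel))
      (eq_iff_eq_of_sub_eq_sub (by dsimp only; abel))
  · intro v f
    rw [h.mem_verts_iff, h.mem_verts_iff]
    exact exists_congr fun t => and_congr_right fun _ =>
      eq_iff_eq_of_sub_eq_sub (by simp only [Equiv.neg_apply]; abel)

/-! ### The check matrices -/

variable [DecidableEq G] [Fintype G]

lemma vertexEdgeMatrix_submatrix (h : IsDoubledStepPolygon m D c) :
    (cyclicPolygons m c).vertexEdgeMatrix.submatrix id h.edgeEquiv =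
      cayleyIncidence (fun s : Fin m => D s) 0 := by
  ext v ⟨w, s⟩
  rw [cayleyIncidence_apply, Matrix.submatrix_apply, PolygonSystem.vertexEdgeMatrix,
    Matrix.of_apply, h.edgeEquiv_coe, id, Pi.zero_apply, add_zero]
  simp only [Sym2.mem_iff]
  have hne : w ≠ w + D s := fun he => h.step_ne_zero s.2 (left_eq_add.1 he)
  by_cases h1 : v = w
  · subst h1
    simp [hne]
  · simp [h1]

/-- The shift that identifies the dual graph with a Cayley graph. -/
def dualShift (c : ℕ → G) (s : Fin m) : G := -c (2 * (s : ℕ) + 1)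

/-- The two faces on the edge `(w, s)` are `w - c (2s + 1)` and its translate by `D s`, so the dual
graph has the same steps as the graph. -/
lemma faceEdgeMatrix_submatrix (h : IsDoubledStepPolygon m D c) :
    (cyclicPolygons m c).faceEdgeMatrix.submatrix id h.edgeEquiv =
      cayleyIncidence (fun s : Fin m => D s) (dualShift c) := by
  ext j ⟨w, s⟩
  rw [cayleyIncidence_apply, Matrix.submatrix_apply, PolygonSystem.faceEdgeMatrix,
    Matrix.of_apply, h.edgeEquiv_coe, h.edge_mem_boundary_iff s.2, id, dualShift]
  have h1 : w = j + c (2 * (s : ℕ) + 1) ↔ j = w + -c (2 * (s : ℕ) + 1) := by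
    rw [← sub_eq_add_neg, eq_sub_iff_add_eq, eq_comm]
  have h2 : w = j + c (2 * (s : ℕ)) ↔ j = w + -c (2 * (s : ℕ) + 1) + D s := by
    rw [h.corner_odd s s.2, eq_comm]
    exact eq_iff_eq_of_sub_eq_sub (by abel)
  simp only [h1, h2]
  have hne : ∀ x, x ≠ x + D s := fun x he => h.step_ne_zero s.2 (left_eq_add.1 he)
  by_cases h3 : j = w + -c (2 * (s : ℕ) + 1)
  · rw [if_pos (Or.inr h3), if_pos h3, if_neg (h3 ▸ hne _), add_zero]
  · simp [h3]

/-- In the contribution of step `s` the middle corner `c (2s + 1)` counts twice and vanishes modulo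
2. What remains telescopes around the closed polygon. -/
lemma cayleyIncidence_mul_transpose (h : IsDoubledStepPolygon m D c) :
    cayleyIncidence (fun s : Fin m => D s) 0 *
      (cayleyIncidence (fun s : Fin m => D s) (dualShift c))ᵀ = 0 := by
  ext v j
  set F : ℕ → ZMod 2 := fun s => if v = j + c (2 * s) then 1 else 0 with hF
  have key : ∀ s : Fin m, ∑ w : G, cayleyIncidence (fun s : Fin m => D s) 0 v (w, s) *
      cayleyIncidence (fun s : Fin m => D s) (dualShift c) j (w, s) = F (s + 1) - F s := by
    intro s
    have h1 : ∀ w, j = w + dualShift c s ↔ w = j + c (2 * (s : ℕ) + 1) := fun w => by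
      rw [dualShift, ← sub_eq_add_neg, eq_sub_iff_add_eq, eq_comm]
    have h2 : ∀ w, j = w + dualShift c s + D s ↔ w = j + c (2 * (s : ℕ)) := fun w => by
      rw [dualShift, h.corner_odd s s.2, eq_comm (a := w)]
      exact eq_iff_eq_of_sub_eq_sub (by abel)
    simp only [cayleyIncidence_apply, h1, h2, Pi.zero_apply, add_zero, mul_add,
      Finset.sum_add_distrib, mul_ite, mul_one, mul_zero, Finset.sum_ite_eq', Finset.mem_univ,
      if_true, hF]
    rw [h.corner_even s s.2, h.corner_odd s s.2]
    simp only [← add_assoc]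
    have two : (2 : ZMod 2) = 0 := rfl
    linear_combination ((if v = j + c (2 * (s : ℕ)) + D s then (1 : ZMod 2) else 0) +
      (if v = j + c (2 * (s : ℕ)) then (1 : ZMod 2) else 0)) * two
  rw [Matrix.mul_apply, Fintype.sum_prod_type_right, Matrix.zero_apply]
  simp only [Matrix.transpose_apply, key]
  rw [Fin.sum_univ_eq_sum_range (fun s => F (s + 1) - F s), Finset.sum_range_sub]
  simp [hF, h.corner_zero, h.corner_two_mul]

lemma vertexEdgeMatrix_mul_transpose (h : IsDoubledStepPolygon m D c) :
    (cyclicPolygons m c).vertexEdgeMatrix * (cyclicPolygons m c).faceEdgeMatrixᵀ = 0 := by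
  have h1 := h.cayleyIncidence_mul_transpose
  rw [← h.vertexEdgeMatrix_submatrix, ← h.faceEdgeMatrix_submatrix, Matrix.transpose_submatrix,
    Matrix.submatrix_mul_equiv] at h1
  exact h1

lemma injective_step (h : IsDoubledStepPolygon m D c) :
    Function.Injective fun s : Fin m => D s :=
  fun s s' hs => Fin.ext (h.step_inj s s.2 s' s'.2 hs)

lemma rank_vertexEdgeMatrix (h : IsDoubledStepPolygon m D c) :
    (cyclicPolygons m c).vertexEdgeMatrix.rank = Fintype.card G - 1 := by
  have hm : 0 < m := by have := h.three_le; omega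
  rw [← rank_cayleyIncidence (fun s : Fin m => D s) 0 ⟨0, hm⟩ h.generates,
    ← h.vertexEdgeMatrix_submatrix]
  exact (Matrix.rank_submatrix _ (Equiv.refl G) h.edgeEquiv).symm

lemma rank_faceEdgeMatrix (h : IsDoubledStepPolygon m D c) :
    (cyclicPolygons m c).faceEdgeMatrix.rank = Fintype.card G - 1 := by
  have hm : 0 < m := by have := h.three_le; omega
  rw [← rank_cayleyIncidence (fun s : Fin m => D s) (dualShift c) ⟨0, hm⟩ h.generates,
    ← h.faceEdgeMatrix_submatrix]
  exact (Matrix.rank_submatrix _ (Equiv.refl G) h.edgeEquiv).symm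

omit [DecidableEq G] [Fintype G] in
lemma hammingNorm_comp_equiv {E E' : Type} [Fintype E] [Fintype E'] (ε : E' ≃ E)
    (z : E → ZMod 2) : hammingNorm (z ∘ ε) = hammingNorm z := by
  rw [hammingNorm, hammingNorm]
  exact Finset.card_equiv ε (by simp)

omit [DecidableEq G] [Fintype G] in
lemma submatrix_mulVec_comp {A E E' : Type} [Fintype E] [Fintype E'] (ε : E' ≃ E)
    (H : Matrix A E (ZMod 2)) (z : E → ZMod 2) :
    H.submatrix id ε *ᵥ (z ∘ ε) = H *ᵥ z := by
  rw [Matrix.submatrix_mulVec_equiv]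
  simp [Function.comp_assoc]

lemma four_le_hammingNorm (h : IsDoubledStepPolygon m D c) (t : Fin m → G)
    {H : Matrix G (cyclicPolygons m c).Edge (ZMod 2)}
    (hH : H.submatrix id h.edgeEquiv = cayleyIncidence (fun s : Fin m => D s) t)
    (z : (cyclicPolygons m c).Edge → ZMod 2) (hz : H *ᵥ z = 0) (hz0 : z ≠ 0) :
    4 ≤ hammingNorm z := by
  rw [← hammingNorm_comp_equiv h.edgeEquiv]
  refine four_le_hammingNorm_of_cayleyIncidence _ t h.injective_step
    (fun s s' => h.step_ne_neg s s.2 s' s'.2) h.triangleFree _ ?_ fun h0 => hz0 ?_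
  · rw [← hH, submatrix_mulVec_comp, hz]
  · funext e
    obtain ⟨p, rfl⟩ := h.edgeEquiv.surjective e
    exact congrFun h0 p

/-- The square `0, D 0, D 0 + D 1, D 1` is a cycle that is not a sum of face boundaries. -/
lemma exists_nontrivial_square (h : IsDoubledStepPolygon m D c) (h3 : D 1 = 3 • D 0)
    (h4 : 4 • D 0 ≠ 0) (h5 : 5 • D 0 ≠ 0) :
    ∃ z, (cyclicPolygons m c).vertexEdgeMatrix *ᵥ z = 0 ∧
      z ∉ rowSpace (cyclicPolygons m c).faceEdgeMatrix ∧ hammingNorm z ≤ 4 := by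
  have hm := h.three_le
  set s₀ : Fin m := ⟨0, by omega⟩ with hs₀
  set s₁ : Fin m := ⟨1, by omega⟩ with hs₁
  have h01 : s₀ ≠ s₁ := by simp [hs₀, hs₁]
  set S : Finset (G × Fin m) := {(0, s₀), (D 1, s₀), (D 0, s₁), (0, s₁)} with hS
  set z' : G × Fin m → ZMod 2 := Pi.single (0, s₀) 1 + Pi.single (D 1, s₀) 1 +
    Pi.single (D 0, s₁) 1 + Pi.single (0, s₁) 1 with hz'
  have hz'S : ∀ p ∉ S, z' p = 0 := by
    intro p hp
    simp only [hS, Finset.mem_insert, Finset.mem_singleton, not_or] at hp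
    simp [hz', hp.1, hp.2.1, hp.2.2.1, hp.2.2.2]
  have hcomp : (z' ∘ h.edgeEquiv.symm) ∘ h.edgeEquiv = z' := by
    funext p; simp
  refine ⟨z' ∘ h.edgeEquiv.symm, ?_, ?_, ?_⟩
  · rw [← submatrix_mulVec_comp h.edgeEquiv, hcomp, h.vertexEdgeMatrix_submatrix]
    funext v
    have two : (2 : ZMod 2) = 0 := rfl
    simp only [hz', Matrix.mulVec_add, Matrix.mulVec_single_one, Pi.add_apply, Matrix.col_apply,
      cayleyIncidence_apply, Pi.zero_apply, add_zero, zero_add, hs₀, hs₁, add_comm (D 1) (D 0)]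
    linear_combination ((if v = 0 then (1 : ZMod 2) else 0) + (if v = D 0 then 1 else 0) +
      (if v = D 1 then 1 else 0) + (if v = D 0 + D 1 then 1 else 0)) * two
  · intro hrow
    rw [rowSpace, ← range_vecMulLinear] at hrow
    obtain ⟨f, hf⟩ := hrow
    have hfz : ∀ p, (f ᵥ* cayleyIncidence (fun s : Fin m => D s) (dualShift c)) p = z' p := by
      intro p
      rw [← h.faceEdgeMatrix_submatrix]
      have := congrFun hf (h.edgeEquiv p)
      rw [Function.comp_apply, Equiv.symm_apply_apply] at this
      exact this
    simp only [vecMul_cayleyIncidence] at hfz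
    have hc1 : dualShift c s₀ = -D 0 := by
      have := h.corner_odd 0 (by omega)
      rw [Nat.mul_zero, h.corner_zero, zero_add, zero_add] at this
      rw [dualShift, hs₀]
      exact congrArg Neg.neg this
    have hc3 : dualShift c s₁ = -(5 • D 0) := by
      have e1 := h.corner_odd 0 (by omega)
      have e2 := h.corner_even 0 (by omega)
      have e3 := h.corner_odd 1 (by omega)
      rw [Nat.mul_zero, h.corner_zero, zero_add, zero_add] at e1
      norm_num at e2 e3
      rw [dualShift, hs₁]
      norm_num
      rw [e3, e2, e1, h3]
      abel
    have n1 : D 0 ≠ 0 := h.step_ne_zero (by omega)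
    have n2 : 2 • D 0 ≠ 0 := fun he => h.step_ne_neg 0 (by omega) 0 (by omega)
      (eq_neg_of_add_eq_zero_left (by rwa [two_nsmul] at he))
    have n3 : 3 • D 0 ≠ 0 := h3 ▸ h.step_ne_zero (s := 1) (by omega)
    -- Sum the relations along the closed dual walk `0, -D 0, -2 D 0, -3 D 0, 0`, which closes
    -- because `D 1 = 3 D 0`. Every value of `f` appears twice, yet the walk crosses only the edge
    -- `(0, s₀)` of the square.
    have q1 := hfz (0, s₀)
    have q2 := hfz (-D 0, s₀)
    have q3 := hfz (-(2 • D 0), s₀)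
    have q4 := hfz (2 • D 0, s₁)
    -- `r1` keeps two edges of the square from cancelling; `r2`, `r3`, `r4`, with `n1` and `n2`,
    -- keep the other three crossed edges off the square.
    have r1 : (0 : G) ≠ 3 • D 0 := n3.symm
    have r2 : -D 0 ≠ 3 • D 0 := fun he => h4 (by
      rw [← sub_eq_zero] at he; rw [← neg_eq_zero, ← he]; abel)
    have r3 : -(2 • D 0) ≠ (3 • D 0 : G) := fun he => h5 (by
      rw [← sub_eq_zero] at he; rw [← neg_eq_zero, ← he]; abel)
    have r4 : 2 • D 0 ≠ D 0 := fun he => n1 (by rwa [two_nsmul, add_eq_left] at he)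
    simp only [hz', Pi.add_apply, Pi.single_apply, Prod.mk.injEq, h01, h01.symm, and_false,
      and_true, if_false, hc1, hc3, h3, r1, r2, r3, r4, n1, n2, neg_eq_zero, add_zero, zero_add,
      if_true] at q1 q2 q3 q4
    have d0 : D (s₀ : ℕ) = D 0 := rfl
    have d1 : D (s₁ : ℕ) = 3 • D 0 := h3
    rw [d0, neg_add_cancel] at q1
    rw [d0, neg_add_cancel_right] at q2
    rw [d0, neg_add_cancel_right] at q3
    rw [d1, show 2 • D 0 + -(5 • D 0) + 3 • D 0 = 0 by abel,
      show 2 • D 0 + -(5 • D 0) = -(2 • D 0) + -D 0 by abel] at q4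
    rw [show -D 0 + -D 0 = -(2 • D 0) by abel] at q2
    have two : (2 : ZMod 2) = 0 := rfl
    exact one_ne_zero (α := ZMod 2) (by
      linear_combination (-1 : ZMod 2) * q1 - q2 - q3 - q4 + (f (-D 0) + f (-(2 • D 0)) + f 0 +
        f (-(2 • D 0) + -D 0)) * two)
  · rw [← hammingNorm_comp_equiv h.edgeEquiv, hcomp]
    refine le_trans (Finset.card_le_card (t := S) fun p hp => ?_) Finset.card_le_four
    by_contra hpS
    rw [Finset.mem_filter_univ] at hp
    exact hp (hz'S p hpS)

lemma card_edge (h : IsDoubledStepPolygon m D c) :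
    Fintype.card (cyclicPolygons m c).Edge = m * Fintype.card G := by
  rw [← Fintype.card_congr h.edgeEquiv, Fintype.card_prod, Fintype.card_fin, mul_comm]

theorem isQuantumCode (h : IsDoubledStepPolygon m D c) (h3 : D 1 = 3 • D 0)
    (h4 : 4 • D 0 ≠ 0) (h5 : 5 • D 0 ≠ 0) :
    IsQuantumCode (homologicalStabilizer (cyclicPolygons m c)) (m * Fintype.card G)
      (2 + (m - 2) * Fintype.card G) 4 := by
  have hcode := isQuantumCode_checkStabilizer h.vertexEdgeMatrix_mul_transpose
    (h.four_le_hammingNorm 0 h.vertexEdgeMatrix_submatrix)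
    (h.four_le_hammingNorm _ h.faceEdgeMatrix_submatrix) (h.exists_nontrivial_square h3 h4 h5)
  rw [h.rank_vertexEdgeMatrix, h.rank_faceEdgeMatrix, h.card_edge] at hcode
  have hm := h.three_le
  have hN : 0 < Fintype.card G := Fintype.card_pos_iff.2 ⟨0⟩
  have hk : m * Fintype.card G - (Fintype.card G - 1) - (Fintype.card G - 1) =
      2 + (m - 2) * Fintype.card G := by
    obtain ⟨k, rfl⟩ : ∃ k, m = k + 2 := ⟨m - 2, by omega⟩
    rw [Nat.add_sub_cancel, add_mul]
    omega
  rwa [hk] at hcode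

end IsDoubledStepPolygon

/-! ### Residues modulo `N` -/

/-- The reduction homomorphism from the integers to `Fin N`. -/
def Fin.residue (N : ℕ) [NeZero N] : ℤ →+ Fin N := zmultiplesHom (Fin N) (Fin.ofNat N 1)

lemma Fin.residue_natCast (N : ℕ) [NeZero N] (n : ℕ) : Fin.residue N n = Fin.ofNat N n := by
  rw [Fin.residue, zmultiplesHom_apply, natCast_zsmul]
  induction n with
  | zero => rw [zero_smul]; exact Fin.ext (Nat.zero_mod N).symm
  | succ n ih =>
    rw [succ_nsmul, ih]
    exact Fin.ext (Nat.add_mod n 1 N).symm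

lemma Fin.residue_eq_zero_iff (N : ℕ) [NeZero N] (k : ℤ) :
    Fin.residue N k = 0 ↔ (N : ℤ) ∣ k := by
  have hnat : ∀ n : ℕ, Fin.residue N n = 0 ↔ (N : ℤ) ∣ n := fun n => by
    rw [Fin.residue_natCast, Int.natCast_dvd_natCast, Nat.dvd_iff_mod_eq_zero, Fin.ext_iff]
    rfl
  obtain ⟨n, rfl | rfl⟩ := k.eq_nat_or_neg
  · exact hnat n
  · rw [map_neg, neg_eq_zero, hnat, dvd_neg]

lemma Fin.residue_eq_iff (N : ℕ) [NeZero N] (k l : ℤ) :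
    Fin.residue N k = Fin.residue N l ↔ (N : ℤ) ∣ k - l := by
  rw [← Fin.residue_eq_zero_iff, map_sub, sub_eq_zero]

lemma Int.eq_zero_of_dvd_of_lt {N S : ℤ} (h : N ∣ S) (h1 : -N < S) (h2 : S < N) : S = 0 :=
  Int.eq_zero_of_abs_lt_dvd h (abs_lt.2 ⟨h1, h2⟩)

lemma Int.eq_of_dvd_of_lt_two_mul {N S : ℤ} (h : N ∣ S) (h1 : -(2 * N) < S) (h2 : S < 2 * N) :
    S = 0 ∨ S = N ∨ S = -N := by
  obtain ⟨k, rfl⟩ := h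
  have hN : 0 < N := by linarith
  have hk1 : -2 < k := by nlinarith
  have hk2 : k < 2 := by nlinarith
  obtain rfl | rfl | rfl : k = -1 ∨ k = 0 ∨ k = 1 := by omega
  · right; right; ring
  · left; ring
  · right; left; ring

/-! ### The maps `K_{2m₁, 3^m₁ + 2m₂ - 1}` as translates of a polygon -/

/-- The steps `1, 3, …, 3^(m - 2), 3^(m - 1) + m₂`. -/
def dattaStep (m m₂ s : ℕ) : ℤ := 3 ^ s + if s + 1 = m then (m₂ : ℤ) else 0

/-- The corners of the polygon, with the last one, equal to `N`, closing it up. -/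
def dattaCorner (m m₂ t : ℕ) : ℤ :=
  cornerOffset t + if t + 1 = 2 * m then (m₂ : ℤ) else if t = 2 * m then 2 * (m₂ : ℤ) else 0

lemma cornerOffset_even (s : ℕ) : (cornerOffset (2 * s) : ℤ) = 3 ^ s - 1 := by
  rw [cornerOffset, if_pos (by omega), Nat.mul_div_cancel_left s two_pos]
  push_cast [Nat.one_le_pow s 3 (by norm_num)]
  rfl

lemma cornerOffset_odd (s : ℕ) : (cornerOffset (2 * s + 1) : ℤ) = 2 * 3 ^ s - 1 := by
  have h := Nat.one_le_pow s 3 (by norm_num)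
  rw [cornerOffset, if_neg (by omega), show (2 * s + 1) / 2 = s by omega,
    Nat.cast_sub (by omega)]
  push_cast
  rfl

lemma dattaCorner_zero (m m₂ : ℕ) (hm : 3 ≤ m) : dattaCorner m m₂ 0 = 0 := by
  have := cornerOffset_even 0
  rw [Nat.mul_zero] at this
  rw [dattaCorner, this, if_neg (by omega), if_neg (by omega)]
  norm_num

lemma dattaCorner_odd (m m₂ s : ℕ) (hs : s < m) :
    dattaCorner m m₂ (2 * s + 1) = dattaCorner m m₂ (2 * s) + dattaStep m m₂ s := by
  rw [dattaCorner, dattaCorner, dattaStep, cornerOffset_even, cornerOffset_odd]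
  split_ifs <;> omega

lemma dattaCorner_even (m m₂ s : ℕ) :
    dattaCorner m m₂ (2 * s + 2) = dattaCorner m m₂ (2 * s + 1) + dattaStep m m₂ s := by
  have := cornerOffset_even (s + 1)
  rw [show 2 * (s + 1) = 2 * s + 2 by ring] at this
  rw [dattaCorner, dattaCorner, dattaStep, this, cornerOffset_odd]
  split_ifs <;> omega

lemma dattaCorner_two_mul (m m₂ : ℕ) :
    dattaCorner m m₂ (2 * m) = ((3 ^ m + 2 * m₂ - 1 : ℕ) : ℤ) := by
  have h := Nat.one_le_pow m 3 (by norm_num)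
  rw [dattaCorner, cornerOffset_even, if_neg (by omega), if_pos rfl, Nat.cast_sub (by omega)]
  push_cast
  ring

lemma dattaStep_pos (m m₂ s : ℕ) : 0 < dattaStep m m₂ s := by
  rw [dattaStep]
  positivity

/-- All steps are positive. As the corners climb from `0` to `N` in a single turn, their residues
are distinct. -/
lemma dattaCorner_lt (m m₂ : ℕ) {i j : ℕ} (hij : i < j) (hj : j ≤ 2 * m) :
    dattaCorner m m₂ i < dattaCorner m m₂ j := by
  induction j, hij using Nat.le_induction with
  | base =>
    rcases Nat.even_or_odd' i with ⟨s, rfl | rfl⟩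
    · rw [dattaCorner_odd m m₂ s (by omega)]
      linarith [dattaStep_pos m m₂ s]
    · rw [dattaCorner_even m m₂ s]
      linarith [dattaStep_pos m m₂ s]
  | succ j _ ih =>
    refine (ih (by omega)).trans ?_
    rcases Nat.even_or_odd' j with ⟨s, rfl | rfl⟩
    · rw [dattaCorner_odd m m₂ s (by omega)]
      linarith [dattaStep_pos m m₂ s]
    · rw [dattaCorner_even m m₂ s]
      linarith [dattaStep_pos m m₂ s]

/-- All steps but the last are odd and at most `q = 3^(m - 2)`, and the last is `3 q + m₂`. -/
lemma dattaStep_cases {m : ℕ} (m₂ : ℕ) (hm : 3 ≤ m) :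
    ∃ p : ℤ, 1 ≤ p ∧ ((3 ^ m + 2 * m₂ - 1 : ℕ) : ℤ) = 9 * (2 * p + 1) + 2 * m₂ - 1 ∧
      ∀ s < m, (s + 1 = m ∧ dattaStep m m₂ s = 3 * (2 * p + 1) + m₂) ∨
        (s + 1 ≠ m ∧ dattaStep m m₂ s = 3 ^ s ∧
          ∃ b, 0 ≤ b ∧ b ≤ p ∧ dattaStep m m₂ s = 2 * b + 1) := by
  have hodd : ∀ s : ℕ, ∃ b : ℤ, 0 ≤ b ∧ (3 : ℤ) ^ s = 2 * b + 1 := fun s => by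
    obtain ⟨b, hb⟩ := (show Odd (3 : ℤ) by decide).pow (n := s)
    have : (0 : ℤ) < 3 ^ s := by positivity
    exact ⟨b, by omega, hb⟩
  obtain ⟨k, rfl⟩ : ∃ k, m = k + 3 := ⟨m - 3, by omega⟩
  -- Here `2 * p + 1` is `q = 3^(m - 2)`, at least 3 because `m ≥ 3`; hence `1 ≤ p`.
  obtain ⟨p, hp0, hp⟩ := hodd (k + 1)
  have h1 := Nat.one_le_pow (k + 3) 3 (by norm_num)
  refine ⟨p, ?_, ?_, fun s hs => ?_⟩
  · have : (0 : ℤ) < 3 ^ k := by positivity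
    rw [pow_succ] at hp
    omega
  · rw [← hp, Nat.cast_sub (by omega)]
    push_cast
    ring
  · by_cases h : s + 1 = k + 3
    · refine Or.inl ⟨h, ?_⟩
      obtain rfl : s = k + 1 + 1 := by omega
      rw [dattaStep, if_pos h, pow_succ, hp]
      ring
    · refine Or.inr ⟨h, by rw [dattaStep, if_neg h, add_zero], ?_⟩
      obtain ⟨b, hb0, hb⟩ := hodd s
      have hle : (3 : ℤ) ^ s ≤ 3 ^ (k + 1) := pow_le_pow_right₀ (by norm_num) (by omega)
      exact ⟨b, hb0, by omega, by rw [dattaStep, if_neg h, add_zero, hb]⟩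

section DattaMap

variable (m m₂ : ℕ) [NeZero (3 ^ m + 2 * m₂ - 1)]

lemma dattaMap_eq_cyclicPolygons (hm : 3 ≤ m) :
    dattaMap m m₂ = cyclicPolygons m
      fun t => Fin.residue (3 ^ m + 2 * m₂ - 1) (dattaCorner m m₂ t) := by
  have : NeZero (2 * m) := ⟨by omega⟩
  rw [dattaMap, cyclicPolygons]
  congr 1
  funext j i
  have hi : (i : ZMod (2 * m)).val < 2 * m := ZMod.val_lt i
  have hc : dattaCorner m m₂ (i : ZMod (2 * m)).val =
      ((cornerOffset i.val + if i.val + 1 = 2 * m then m₂ else 0 : ℕ) : ℤ) := by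
    rw [dattaCorner, if_neg hi.ne]
    push_cast
    rfl
  rw [hc, Fin.residue_natCast]
  refine Fin.ext ?_
  rw [Fin.val_add, Fin.val_ofNat, Nat.add_mod_mod, ← add_assoc]

lemma isDoubledStepPolygon_datta (hm : 3 ≤ m) :
    IsDoubledStepPolygon m (fun s => Fin.residue (3 ^ m + 2 * m₂ - 1) (dattaStep m m₂ s))
      fun t => Fin.residue (3 ^ m + 2 * m₂ - 1) (dattaCorner m m₂ t) := by
  obtain ⟨p, hp, hN, hstep⟩ := dattaStep_cases m₂ hm
  have hstep0 : dattaStep m m₂ 0 = 1 := by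
    rw [dattaStep, if_neg (by omega), pow_zero, add_zero]
  refine
    { three_le := hm
      corner_zero := by rw [dattaCorner_zero m m₂ hm, map_zero]
      corner_odd := fun s hs => by rw [dattaCorner_odd m m₂ s hs, map_add]
      corner_even := fun s _ => by rw [dattaCorner_even m m₂ s, map_add]
      corner_two_mul := by
        rw [dattaCorner_two_mul, Fin.residue_eq_zero_iff]
      corner_inj := ?_
      step_inj := ?_
      step_ne_neg := ?_
      generates := fun x => ⟨x.val, ?_⟩
      triangleFree := ?_ }
  · have hbound : ∀ i < 2 * m, 0 ≤ dattaCorner m m₂ i ∧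
        dattaCorner m m₂ i < ((3 ^ m + 2 * m₂ - 1 : ℕ) : ℤ) := fun i hi => by
      refine ⟨?_, dattaCorner_two_mul m m₂ ▸ dattaCorner_lt m m₂ hi le_rfl⟩
      rcases Nat.eq_zero_or_pos i with rfl | h0
      · exact (dattaCorner_zero m m₂ hm).ge
      · exact (dattaCorner_zero m m₂ hm).symm.le.trans (dattaCorner_lt m m₂ h0 hi.le).le
    intro i hi j hj hij
    have h0 := Int.eq_zero_of_dvd_of_lt ((Fin.residue_eq_iff _ _ _).1 hij)
      (by linarith [(hbound i hi).1, (hbound j hj).2])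
      (by linarith [(hbound j hj).1, (hbound i hi).2])
    rcases lt_trichotomy i j with h | h | h
    · linarith [dattaCorner_lt m m₂ h hj.le]
    · exact h
    · linarith [dattaCorner_lt m m₂ h hi.le]
  · intro i hi j hj hij
    have hdvd := (Fin.residue_eq_iff _ _ _).1 hij
    rcases hstep i hi with ⟨h1, h2⟩ | ⟨h1, h2, b, hb0, hbp, hb⟩ <;>
    rcases hstep j hj with ⟨h1', h2'⟩ | ⟨h1', h2', b', hb0', hbp', hb'⟩
    · omega
    · have := Int.eq_zero_of_dvd_of_lt hdvd (by omega) (by omega)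
      omega
    · have := Int.eq_zero_of_dvd_of_lt hdvd (by omega) (by omega)
      omega
    · have := Int.eq_zero_of_dvd_of_lt hdvd (by omega) (by omega)
      rw [h2, h2', sub_eq_zero] at this
      exact pow_right_injective₀ (by norm_num) (by norm_num) this
  · intro i hi j hj hij
    rw [← map_neg] at hij
    have hdvd := (Fin.residue_eq_iff _ _ _).1 hij
    have hpos := dattaStep_pos m m₂ i
    have hpos' := dattaStep_pos m m₂ j
    -- Two steps sum to at most `6q + 2m₂ < N`, and their sum is positive.
    have := Int.eq_zero_of_dvd_of_lt hdvd (by omega) (by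
      rcases hstep i hi with ⟨h1, h2⟩ | ⟨h1, h2, b, hb0, hbp, hb⟩ <;>
      rcases hstep j hj with ⟨h1', h2'⟩ | ⟨h1', h2', b', hb0', hbp', hb'⟩ <;> omega)
    omega
  · simp only [hstep0]
    rw [← map_nsmul, nsmul_one, Fin.residue_natCast]
    exact Fin.ext (Nat.mod_eq_of_lt x.2)
  · have hmem : ∀ x ∈ signedSteps
        (fun s : Fin m => Fin.residue (3 ^ m + 2 * m₂ - 1) (dattaStep m m₂ s)),
        ∃ a : ℤ, Fin.residue (3 ^ m + 2 * m₂ - 1) a = x ∧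
          (a = 3 * (2 * p + 1) + m₂ ∨ a = -(3 * (2 * p + 1) + m₂) ∨
            ∃ b, a = 2 * b + 1 ∧ -(2 * p + 1) ≤ a ∧ a ≤ 2 * p + 1) := by
      rintro x ⟨s, rfl | rfl⟩
      · refine ⟨_, rfl, ?_⟩
        rcases hstep s s.2 with ⟨h1, h2⟩ | ⟨h1, h2, b, hb0, hbp, hb⟩
        · exact Or.inl h2
        · exact Or.inr (Or.inr ⟨b, hb, by omega, by omega⟩)
      · refine ⟨_, map_neg _ _, ?_⟩
        rcases hstep s s.2 with ⟨h1, h2⟩ | ⟨h1, h2, b, hb0, hbp, hb⟩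
        · exact Or.inr (Or.inl (by rw [h2]))
        · exact Or.inr (Or.inr ⟨-b - 1, by omega, by omega, by omega⟩)
    intro x hx y hy z hz hxyz
    obtain ⟨a, rfl, ha⟩ := hmem x hx
    obtain ⟨b, rfl, hb⟩ := hmem y hy
    obtain ⟨c, rfl, hc⟩ := hmem z hz
    rw [← map_add, ← map_add, Fin.residue_eq_zero_iff] at hxyz
    have hbound : ∀ a : ℤ, (a = 3 * (2 * p + 1) + m₂ ∨ a = -(3 * (2 * p + 1) + m₂) ∨
        ∃ b, a = 2 * b + 1 ∧ -(2 * p + 1) ≤ a ∧ a ≤ 2 * p + 1) →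
        -(3 * (2 * p + 1) + m₂) ≤ a ∧ a ≤ 3 * (2 * p + 1) + m₂ := by
      rintro a (h | h | ⟨b, -, h1, h2⟩) <;> omega
    obtain ⟨a1, a2⟩ := hbound a ha
    obtain ⟨b1, b2⟩ := hbound b hb
    obtain ⟨c1, c2⟩ := hbound c hc
    -- Three steps sum to at most `9q + 3m₂ < 2N` in absolute value.
    have hS := Int.eq_of_dvd_of_lt_two_mul hxyz (by linarith) (by linarith)
    rw [hN] at hS
    clear hbound a1 a2 b1 b2 c1 c2 hmem hx hy hz hxyz hstep hstep0 hN
    -- Let `L = 3q + m₂`. For sum `0`: three short steps have odd sum, `L - L` leaves an odd term,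
    -- and otherwise the terms `±L` dominate. For sum `±N`: two equal terms `±L` would need a third
    -- of size `3q - 1 > q`, three equal ones would need `m₂ = -1`, and all other sums are too
    -- small.
    rcases ha with ha | ha | ⟨a', ha, ha1, ha2⟩ <;> rcases hb with hb | hb | ⟨b', hb, hb1, hb2⟩ <;>
      rcases hc with hc | hc | ⟨c', hc, hc1, hc2⟩ <;> omega

end DattaMap

/-! ### Parameters and rate of the family -/

lemma isQuantumCode_dattaMap (m m₂ : ℕ) (hm : 3 ≤ m) :
    (dattaMap m m₂).IsEquivelar (2 * m) (2 * m) ∧ (dattaMap m m₂).IsSelfDual ∧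
      (dattaMap m m₂).vertexEdgeMatrix * (dattaMap m m₂).faceEdgeMatrixᵀ = 0 ∧
      IsQuantumCode (homologicalStabilizer (dattaMap m m₂)) (m * (3 ^ m + 2 * m₂ - 1))
        (2 + (m - 2) * (3 ^ m + 2 * m₂ - 1)) 4 := by
  obtain ⟨p, hp, hN, -⟩ := dattaStep_cases m₂ hm
  have : NeZero (3 ^ m + 2 * m₂ - 1) := ⟨by omega⟩
  have h := isDoubledStepPolygon_datta m m₂ hm
  rw [dattaMap_eq_cyclicPolygons m m₂ hm]
  refine ⟨h.isEquivelar, h.isSelfDual, h.vertexEdgeMatrix_mul_transpose, ?_⟩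
  have h0 : dattaStep m m₂ 0 = 1 := by
    rw [dattaStep, if_neg (by omega), pow_zero, add_zero]
  have h1 : dattaStep m m₂ 1 = 3 := by
    rw [dattaStep, if_neg (by omega), pow_one, add_zero]
  have hsmall : ∀ k : ℕ, 0 < k → k < 6 →
      k • Fin.residue (3 ^ m + 2 * m₂ - 1) (dattaStep m m₂ 0) ≠ 0 := by
    intro k hk0 hk6 hk
    rw [← map_nsmul, h0, Fin.residue_eq_zero_iff, nsmul_one] at hk
    -- `N ≥ 26` because `p ≥ 1`.
    have := Int.le_of_dvd (by exact_mod_cast hk0) hk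
    omega
  have hcode := h.isQuantumCode
    (by simp only [h0, h1]; rw [← map_nsmul]; rfl) (hsmall 4 (by norm_num) (by norm_num))
    (hsmall 5 (by norm_num) (by norm_num))
  rwa [Fintype.card_fin] at hcode

lemma encodingRate_eq {E : Type} [Fintype E] [DecidableEq E] {S : Subgroup (QubitOp E)ˣ}
    {n k d : ℕ} (h : IsQuantumCode S n k d) : encodingRate S = k / n := by
  rw [encodingRate, h.dimension, h.length]
  push_cast
  rw [Real.logb_pow, Real.logb_self_eq_one one_lt_two, mul_one]

lemma dist_encodingRate_dattaMap_le (m m₂ : ℕ) (hm : 3 ≤ m) :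
    ‖encodingRate (homologicalStabilizer (dattaMap m m₂)) - 1‖ ≤ 2 / m := by
  rw [encodingRate_eq (isQuantumCode_dattaMap m m₂ hm).2.2.2]
  have hN : 1 ≤ 3 ^ m + 2 * m₂ - 1 := by
    obtain ⟨p, hp, hN, -⟩ := dattaStep_cases m₂ hm
    omega
  generalize 3 ^ m + 2 * m₂ - 1 = N at hN
  obtain ⟨k, rfl⟩ : ∃ k, m = k + 2 := ⟨m - 2, by omega⟩
  have hN' : (1 : ℝ) ≤ N := by exact_mod_cast hN
  have hk : (0 : ℝ) ≤ k := Nat.cast_nonneg k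
  rw [Nat.add_sub_cancel]
  push_cast
  have h1 : (2 + (k : ℝ) * N) / ((k + 2) * N) - 1 = -((2 * N - 2) / ((k + 2) * N)) := by
    field_simp
    ring
  rw [h1, norm_neg, Real.norm_of_nonneg (div_nonneg (by linarith) (by positivity)),
    div_le_div_iff₀ (by positivity) (by positivity)]
  nlinarith

theorem mainTheorem2 :
    (∀ m₁ m₂ : ℕ, 3 ≤ m₁ →
      (dattaMap m₁ m₂).IsEquivelar (2 * m₁) (2 * m₁) ∧
      (dattaMap m₁ m₂).IsSelfDual ∧
      (dattaMap m₁ m₂).vertexEdgeMatrix * (dattaMap m₁ m₂).faceEdgeMatrixᵀ = 0 ∧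
      IsQuantumCode (homologicalStabilizer (dattaMap m₁ m₂))
        (m₁ * (3 ^ m₁ + 2 * m₂ - 1))
        (2 + (m₁ - 2) * (3 ^ m₁ + 2 * m₂ - 1))
        4) ∧
    Tendsto (fun m : ℕ × ℕ => encodingRate (homologicalStabilizer (dattaMap m.1 m.2)))
      (atTop ×ˢ (⊤ : Filter ℕ)) (𝓝 1) := by
  refine ⟨isQuantumCode_dattaMap, ?_⟩
  rw [tendsto_iff_norm_sub_tendsto_zero]
  -- The bound `2 / m₁` does not involve `m₂`; this uniformity is what the filter `⊤` in the second
  -- factor expresses.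
  refine squeeze_zero' (Eventually.of_forall fun _ => norm_nonneg _)
    (((eventually_ge_atTop 3).prod_inl ⊤).mono fun m hm => dist_encodingRate_dattaMap_le m.1 m.2 hm)
    ((tendsto_const_div_atTop_nhds_zero_nat (2 : ℝ)).comp tendsto_fst)
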